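/- **Setting.** Let $c,\beta>0$, $\kappa=\frac{4}{c^2}e^{-c^2/4}$ with $2\kappa<1$, and for $\eta>0$ let $$l_\eta=\frac{e^{-\eta}}{1-\kappa},\quad U_\eta=\sqrt2\sqrt{d+2\sqrt{d\eta}+2\eta},\quad L_\eta=\sqrt2\sqrt{d-2\sqrt{d\eta}},\quad \Delta_1=\frac{U_\eta}{L_\eta-2c}-1,\quad \Delta_2=\frac{U_\eta+2c}{L_\eta-2c}-1 .$$ Put $l=l_\beta$. Let $f\in(0,1]$, $\varepsilon,\delta\in(0,1)$, $\hat f=f/(1-2\kappa)$, and $r=U_\beta+2c=\sqrt2\sqrt{d+2\sqrt{d\beta}+2\beta}+2c$. *Data.* A stream $x_1,\dots,x_n$ of independent points comes, in an arbitrary fixed order, from $d$-dimensional ($d\ge1$) Gaussians $Z_1,\dots,Z_K$ with identity covariance whose means are infinitely far apart: two points of the same Gaussian have their Euclidean distance, two points of different Gaussians have distance $\infty$. Let $f_k$ be the empirical frequency of $Z_k$, i.e. the fraction of the $x_t$ that come from it. For a point $p$, $r_g(p)$ is the smallest $\rho\in[0,\infty]$ such that at least $gn$ data points are within distance $\rho$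 of $p$ ($\infty$ if there is none). *Algorithm.* HAC with radius $r$, frequency $f$ and parameters $\varepsilon,\delta$ has $m=\lceil \log(1/(f\delta))/(f\varepsilon)\rceil$ memory cells. When $x_t$ arrives, each cell independently, with probability $1/t$, replaces its stored point by $x_t$ and resets its counter to $0$; then its counter increases by $1$ if $x_t$ is within $r$ of its stored point. The outputs, with associated radius $r$, are the stored points whose final counter is at least $(1-\varepsilon)fn$. Fix $k$ and let $p\sim Z_k$ be independent of the stream and of the algorithm. **Theorem.** (0) For every fixed $\eta\ge\beta$, as $d\to\infty$, $\Delta_1=c\sqrt{2/d}+2\sqrt{\eta/d}+O(d^{-1})$ and $\Delta_2=2c\sqrt{2/d}+2\sqrt{\eta/d}+O(d^{-1})$; in particular both are $O(d^{-1/2})$. (1) Let $\eta\ge\beta$ with $2l_\eta f_k\le f$ and $L_\eta>2c$ (for $\eta=\beta$ the parameters are those of the radius; some $\eta$ depending only on $c,\beta,f$ always satisfies the first condition, and then all large $d$ satisfy the second). Then, with probability at least $$1-\kappa-\delta f-e^{-fn/3}\left(e^{\kappa}+e^{l}\right),$$ if $r_{\hat f}(p)\le r$ then there is an output $o$ with $\mathrm{dist}(p,o)\le(1+\Delta_1)\,r_f(p)$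 and $r_f(o)\le r$, whose associated radius satisfies $r\le(1+\Delta_2)\,r_f(p)$. If moreover $\hat f\le(1-2l)f_k$, then the same lower bound holds for the conditional probability, given $r_{\hat f}(p)\le r$, that there is such an output. (2) The probability that $r_{(1-\varepsilon)(1-2l)f}(p)>r$ and yet some output is at finite distance from $p$ (in particular, that some output is within distance $r$ of $p$) is at most $\kappa+e^{-fn/3}$. -/

import Mathlib

open MeasureTheory ProbabilityTheory Filter Asymptotics
open scoped ENNReal

noncomputable section

namespace HopAndCount

/-! ### Dense points and the Hop And Count algorithm in an extended metric space -/

section Algorithm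

variable {X : Type*} [PseudoEMetricSpace X]

open Classical in
/-- The number of indices `t` for which the data point `x t` is within distance `r` of `p`. -/
def ballCount {n : ℕ} (x : Fin n → X) (p : X) (r : ℝ≥0∞) : ℕ :=
  (Finset.univ.filter fun t => edist p (x t) ≤ r).card

/-- `p` is `(r, f)`-dense with respect to the dataset `x` of size `n`. -/
def IsDense {n : ℕ} (x : Fin n → X) (r : ℝ≥0∞) (f : ℝ) (p : X) : Prop :=
  f * n ≤ ballCount x p r

/-- `r_f(p)`: the smallest `r` such that `p` is `(r, f)`-dense (`⊤` if there is none). -/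
def densityRadius {n : ℕ} (x : Fin n → X) (f : ℝ) (p : X) : ℝ≥0∞ :=
  sInf {r | IsDense x r f p}

open Classical in
/-- One memory cell after one more stream point `x`: if `hop` then the cell moves to `x` and its
counter is reset; after that the counter is increased if `x` is within `r` of the stored point. -/
def cellStep (r : ℝ≥0∞) (x : X) (hop : Bool) (s : Option (X × ℕ)) : Option (X × ℕ) :=
  (if hop then some (x, 0) else s).map fun a =>
    (a.1, if edist a.1 x ≤ r then a.2 + 1 else a.2)

/-- The state (stored point and counter) of one memory cell, empty at the start, after the stream
`x 0, …, x (n - 1)`, if `hop t` says whether the cell hops when `x t` arrives. -/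
def cellRun (r : ℝ≥0∞) : (n : ℕ) → (Fin n → X) → (Fin n → Bool) → Option (X × ℕ)
  | 0, _, _ => none
  | n + 1, x, hop =>
      cellStep r (x (Fin.last n)) (hop (Fin.last n))
        (cellRun r n (fun t => x t.castSucc) (fun t => hop t.castSucc))

/-- The number of memory cells, `log (1 / (f δ)) / (f ε)` rounded up. -/
def memorySize (f ε δ : ℝ) : ℕ := ⌈Real.log (1 / (f * δ)) / (f * ε)⌉₊

/-- The outputs of Hop And Count run with the single radius `r`: the pairs `(o, r)` where `o` is the
point stored in some memory cell whose counter is at least `(1 - ε) f n`. -/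
def outputs (r : ℝ≥0∞) (f ε : ℝ) {n m : ℕ} (x : Fin n → X) (hop : Fin m → Fin n → Bool) :
    Set (X × ℝ≥0∞) :=
  {a | a.2 = r ∧ ∃ (i : Fin m) (cnt : ℕ),
    cellRun r n x (hop i) = some (a.1, cnt) ∧ (1 - ε) * f * n ≤ cnt}

end Algorithm

/-- The probability `1 / t` of hopping to the `t`-th stream point, where `t = i + 1`. -/
def hopProb (i : ℕ) : unitInterval :=
  ⟨1 / ((i : ℝ) + 1), by positivity, by
    rw [div_le_one (by positivity)]
    linarith [Nat.cast_nonneg (α := ℝ) i]⟩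

/-- The law of all the hops of `m` memory cells along a stream of length `n`: independent, and the
hop to the `t`-th stream point has probability `1 / t`. -/
def hopLaw (m n : ℕ) : Measure (Fin m → Fin n → Bool) :=
  Measure.pi fun _ => Measure.pi fun t => bernoulliMeasure true false (hopProb t)

/-! ### Gaussians with means infinitely far apart -/

/-- A point of the union of `K` copies of `ℝ^d` at infinite distance from each other. Copy `i` is
the space around the mean of the `i`-th Gaussian, and `pos` is the displacement from that mean. -/
structure FarPoint (K d : ℕ) where
  cluster : Fin K
  pos : EuclideanSpace ℝ (Fin d)

/-- The distance is Euclidean around the same mean and infinite otherwise. -/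
instance (K d : ℕ) : PseudoEMetricSpace (FarPoint K d) where
  edist a b := if a.cluster = b.cluster then edist a.pos b.pos else ⊤
  edist_self a := by simp
  edist_comm a b := by simp only [eq_comm, edist_comm]
  edist_triangle a b c := by
    by_cases h₁ : a.cluster = b.cluster
    · by_cases h₂ : b.cluster = c.cluster
      · simpa [h₁, h₂] using edist_triangle a.pos b.pos c.pos
      · simp [h₂]
    · simp [h₁]

/-- The random experiment: a point from a standard Gaussian, `n` data points from standard
Gaussians (all seen from the respective mean), and the hops of the `m` memory cells, all
independent. -/
abbrev Sample (d n m : ℕ) : Type :=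
  EuclideanSpace ℝ (Fin d) × (Fin n → EuclideanSpace ℝ (Fin d)) × (Fin m → Fin n → Bool)

/-- The law of the random experiment. -/
def law (d n m : ℕ) : Measure (Sample d n m) :=
  (stdGaussian (EuclideanSpace ℝ (Fin d))).prod
    ((Measure.pi fun _ => stdGaussian (EuclideanSpace ℝ (Fin d))).prod (hopLaw m n))

/-- The point `p`, drawn from the `k`-th Gaussian. -/
def point {K d n m : ℕ} (k : Fin K) (ω : Sample d n m) : FarPoint K d := ⟨k, ω.1⟩

/-- The stream of data; the `t`-th data point is drawn from the Gaussian number `lab t`. -/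
def stream {K d n m : ℕ} (lab : Fin n → Fin K) (ω : Sample d n m) : Fin n → FarPoint K d :=
  fun t => ⟨lab t, ω.2.1 t⟩

/-- The empirical frequency of the `k`-th Gaussian. -/
def freq {K n : ℕ} (lab : Fin n → Fin K) (k : Fin K) : ℝ :=
  ((Finset.univ.filter fun t => lab t = k).card : ℝ) / n

/-! ### The parameters -/

/-- `κ = (4 / c²) exp (-c² / 4)`. -/
def kappa (c : ℝ) : ℝ := 4 / c ^ 2 * Real.exp (-c ^ 2 / 4)

/-- `l = exp (-β) / (1 - κ)`. -/
def ell (c β : ℝ) : ℝ := Real.exp (-β) / (1 - kappa c)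

/-- `f̂ = f / (1 - 2κ)`. -/
def fHat (c f : ℝ) : ℝ := f / (1 - 2 * kappa c)

/-- `U = √2 √(d + 2 √(d β) + 2 β)`. -/
def upperDist (β : ℝ) (d : ℕ) : ℝ :=
  Real.sqrt 2 * Real.sqrt (d + 2 * Real.sqrt (d * β) + 2 * β)

/-- `L = √2 √(d - 2 √(d β))`. -/
def lowerDist (β : ℝ) (d : ℕ) : ℝ :=
  Real.sqrt 2 * Real.sqrt (d - 2 * Real.sqrt (d * β))

/-- The radius `r = U + 2 c` with which the algorithm is run. -/
def hacRadius (c β : ℝ) (d : ℕ) : ℝ≥0∞ := ENNReal.ofReal (upperDist β d + 2 * c)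

/-- `Δ₁ = U / (L - 2 c) - 1`. -/
def delta₁ (c β : ℝ) (d : ℕ) : ℝ := upperDist β d / (lowerDist β d - 2 * c) - 1

/-- `Δ₂ = (U + 2 c) / (L - 2 c) - 1`. -/
def delta₂ (c β : ℝ) (d : ℕ) : ℝ := (upperDist β d + 2 * c) / (lowerDist β d - 2 * c) - 1

/-! ### The events -/

section Events

variable {K d n : ℕ} (c β f ε δ : ℝ) (lab : Fin n → Fin K) (k : Fin K)

/-- The outputs of Hop And Count run with radius `r = U + 2 c` on the stream. -/
def hacOutputs (ω : Sample d n (memorySize f ε δ)) : Set (FarPoint K d × ℝ≥0∞) :=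
  outputs (hacRadius c β d) f ε (stream lab ω) ω.2.2

/-- The event `r_f̂(p) ≤ r`. -/
def denseEvent : Set (Sample d n (memorySize f ε δ)) :=
  {ω | densityRadius (stream lab ω) (fHat c f) (point k ω) ≤ hacRadius c β d}

/-- There is an output `o`, with associated radius `ρ` such that `r_f(o) ≤ ρ`, for which
`dist(p, o) ≤ (1 + Δ₁) r_f(p)` and `ρ ≤ (1 + Δ₂) r_f(p)`. -/
def coveredEvent (Δ₁ Δ₂ : ℝ) : Set (Sample d n (memorySize f ε δ)) :=
  {ω | ∃ o ρ, (o, ρ) ∈ hacOutputs c β f ε δ lab ω ∧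
    edist (point k ω) o ≤
      ENNReal.ofReal (1 + Δ₁) * densityRadius (stream lab ω) f (point k ω) ∧
    densityRadius (stream lab ω) f o ≤ ρ ∧
    ρ ≤ ENNReal.ofReal (1 + Δ₂) * densityRadius (stream lab ω) f (point k ω)}

/-- `r_{(1-ε)(1-2l)f}(p) > r`, yet some output is at finite distance from `p`. -/
def falsePositiveEvent : Set (Sample d n (memorySize f ε δ)) :=
  {ω | hacRadius c β d <
      densityRadius (stream lab ω) ((1 - ε) * (1 - 2 * ell c β) * f) (point k ω) ∧
    ∃ o ρ, (o, ρ) ∈ hacOutputs c β f ε δ lab ω ∧ edist (point k ω) o < ⊤}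

end Events

end HopAndCount

end

/-! Reservoir sampling drives the algorithm. The last hop of a cell is uniform over the stream
(`pi_bernoulli_real_lastHop`), and the final counter is the number of points from that hop on that
lie within `r` of the stored point (`cellRun_of_mem_lastHop`). Let `N` be the number of members of
cluster `k`. A cell that ends at one of the first `⌈ε f n⌉` members, with at most `N - f n` members
farther than `r`, is therefore an output.

Call such an early member good if it also lies within `U + c` of `p`. Given the data, all cells miss
the good ones with probability at most `f δ` plus the proportion of bad ones
(`hopLaw_real_miss_le`); averaging over the data turns this proportion into the probability that a
fixed member is bad (`law_real_miss_le`). The rest is deterministic (`mem_coveredEvent`): if few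
members are closer to `p` than `L - c`, then `r_f(p) ≥ L - c`, and `Δ₁`, `Δ₂` compare `U + c` and
`r` with `L - c`.

All geometric errors come from χ² tails for the distance of two independent Gaussian points,
followed by Markov's inequality for the number of bad members; they add up to at most `3κ/5`. The
terms with `exp (-f n / 3)` are slack, except that they cover `n = 0`.

For false positives, an output at finite distance from `p` forces `N ≥ (1 - ε) f n`. If `p` is
nevertheless sparse, at least `2 l N` members are far from `p`, which Markov's inequality makes
unlikely. -/

noncomputable section

namespace HopAndCount

/-! ### χ² tails and the distance of two Gaussian points. -/

section GaussianTails

lemma integral_exp_mul_sq_gaussianReal {t : ℝ} (ht : t < 1 / 2) :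
    ∫ x, Real.exp (t * x ^ 2) ∂(gaussianReal 0 1) = (Real.sqrt (1 - 2 * t))⁻¹ := by
  rw [integral_gaussianReal_eq_integral_smul one_ne_zero]
  have h (x : ℝ) : gaussianPDFReal 0 1 x • Real.exp (t * x ^ 2) =
      (Real.sqrt (2 * Real.pi))⁻¹ * Real.exp (-(1 / 2 - t) * x ^ 2) := by
    simp only [gaussianPDFReal, smul_eq_mul, NNReal.coe_one, mul_one, sub_zero]
    rw [mul_assoc, ← Real.exp_add]
    congr 2
    ring
  simp_rw [h]
  rw [integral_const_mul, integral_gaussian, ← Real.sqrt_inv, ← Real.sqrt_mul (by positivity),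
    ← Real.sqrt_inv]
  congr 1
  have h1 : 1 / 2 - t ≠ 0 := by linarith
  have h2 : 1 - 2 * t ≠ 0 := by linarith
  field_simp

lemma mgf_norm_sq_stdGaussian (d : ℕ) {t : ℝ} (ht : t < 1 / 2) :
    mgf (fun z => ‖z‖ ^ 2) (stdGaussian (EuclideanSpace ℝ (Fin d))) t
      = Real.exp (-(d / 2) * Real.log (1 - 2 * t)) := by
  have h2 : 0 < 1 - 2 * t := by linarith
  rw [mgf, ← map_pi_eq_stdGaussian, integral_map (by fun_prop) (by fun_prop)]
  have h (x : Fin d → ℝ) : Real.exp (t * ‖WithLp.toLp 2 x‖ ^ 2)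
      = ∏ i, Real.exp (t * x i ^ 2) := by
    rw [EuclideanSpace.real_norm_sq_eq, Finset.mul_sum, Real.exp_sum]
  simp_rw [h]
  rw [integral_fintype_prod_eq_pow (fun x : ℝ => Real.exp (t * x ^ 2)),
    integral_exp_mul_sq_gaussianReal ht, Fintype.card_fin, ← Real.exp_log (Real.sqrt_pos.2 h2),
    ← Real.exp_neg, ← Real.exp_nat_mul, Real.log_sqrt h2.le]
  congr 1
  ring

lemma integrable_exp_mul_norm_sq_stdGaussian (d : ℕ) {t : ℝ} (ht : t < 1 / 2) :
    Integrable (fun z => Real.exp (t * ‖z‖ ^ 2)) (stdGaussian (EuclideanSpace ℝ (Fin d))) := by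
  -- The integral of a non-integrable function is `0` by convention, but the computed value is an
  -- exponential.
  by_contra h
  have h1 := mgf_norm_sq_stdGaussian d ht
  rw [mgf, integral_undef h] at h1
  exact (Real.exp_pos _).ne h1

/-- This is `y ≤ sinh y` at `y = -log (1 - x)`. -/
lemma neg_log_one_sub_le {x : ℝ} (h0 : 0 ≤ x) (h1 : x < 1) :
    -Real.log (1 - x) ≤ x + x ^ 2 / (2 * (1 - x)) := by
  have hx : 0 < 1 - x := by linarith
  have h2 : 0 ≤ -Real.log (1 - x) := by
    have := Real.log_nonpos hx.le (by linarith)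
    linarith
  have h3 := Real.self_le_sinh_iff.2 h2
  rw [Real.sinh_eq, neg_neg, Real.exp_neg, Real.exp_log hx] at h3
  refine h3.trans (le_of_eq ?_)
  field_simp
  ring

lemma add_sq_div_two_le_neg_log_one_sub {x : ℝ} (h0 : 0 ≤ x) (h1 : x < 1) :
    x + x ^ 2 / 2 ≤ -Real.log (1 - x) := by
  have h := Real.hasSum_pow_div_log_of_abs_lt_one (x := x) (by rwa [abs_of_nonneg h0])
  have h2 := h.summable.sum_le_tsum (Finset.range 2) (fun i _ => by positivity)
  rw [h.tsum_eq] at h2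
  norm_num [Finset.sum_range_succ] at h2
  linarith

/-- The upper tail of a `χ²` variable. -/
lemma stdGaussian_real_le_norm_sq {d : ℕ} (hd : 0 < d) {η : ℝ} (hη : 0 ≤ η) :
    (stdGaussian (EuclideanSpace ℝ (Fin d))).real
      {z | d + 2 * Real.sqrt (d * η) + 2 * η ≤ ‖z‖ ^ 2} ≤ Real.exp (-η) := by
  have hd' : (0 : ℝ) < d := by exact_mod_cast hd
  obtain ⟨a, ha, had⟩ : ∃ a : ℝ, 0 < a ∧ a ^ 2 = d :=
    ⟨Real.sqrt d, Real.sqrt_pos.2 hd', Real.sq_sqrt hd'.le⟩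
  obtain ⟨b, hb, hbη⟩ : ∃ b : ℝ, 0 ≤ b ∧ b ^ 2 = η :=
    ⟨Real.sqrt η, Real.sqrt_nonneg _, Real.sq_sqrt hη⟩
  have hab : Real.sqrt (d * η) = a * b := by
    rw [← had, ← hbη, ← mul_pow, Real.sqrt_sq (by positivity)]
  -- The minimiser of the Chernoff bound; the exponent becomes exactly `-b ^ 2 = -η`.
  set t := b / (a + 2 * b) with ht
  have hs : 0 < a + 2 * b := by positivity
  have ht0 : 0 ≤ t := by positivity
  have h1t : 1 - 2 * t = a / (a + 2 * b) := by rw [ht]; field_simp; ring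
  have h1 : 0 < 1 - 2 * t := by rw [h1t]; positivity
  have h := measure_ge_le_exp_mul_mgf (μ := stdGaussian (EuclideanSpace ℝ (Fin d)))
    (X := fun z => ‖z‖ ^ 2) (d + 2 * Real.sqrt (d * η) + 2 * η) ht0
    (integrable_exp_mul_norm_sq_stdGaussian d (by linarith))
  refine h.trans ?_
  rw [mgf_norm_sq_stdGaussian d (by linarith), ← Real.exp_add, Real.exp_le_exp, hab]
  have h2 := neg_log_one_sub_le (x := 2 * t) (by positivity) (by linarith)
  have h3 : -(d / 2 : ℝ) * Real.log (1 - 2 * t)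
      ≤ d / 2 * (2 * t + (2 * t) ^ 2 / (2 * (1 - 2 * t))) := by
    have := mul_le_mul_of_nonneg_left h2 (by positivity : (0 : ℝ) ≤ d / 2)
    linarith
  refine (add_le_add_right h3 _).trans (le_of_eq ?_)
  rw [h1t, ht, ← had, ← hbη]
  field_simp
  ring

/-- The lower tail of a `χ²` variable. -/
lemma stdGaussian_real_norm_sq_le (d : ℕ) {u : ℝ} (hu : 0 < u) (hu1 : u ≤ 1) :
    (stdGaussian (EuclideanSpace ℝ (Fin d))).real {z | ‖z‖ ^ 2 ≤ d * u ^ 2}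
      ≤ Real.exp (-(d * ((u ^ 2 - 1) / 2 - Real.log u))) := by
  -- The optimal tilt: under it each coordinate has variance `1 / (1 - 2 * t) = u ^ 2`.
  set t := (1 - (u ^ 2)⁻¹) / 2 with ht
  have hu2 : 1 ≤ (u ^ 2)⁻¹ := (one_le_inv₀ (by positivity)).2 (by nlinarith)
  have h := measure_le_le_exp_mul_mgf (μ := stdGaussian (EuclideanSpace ℝ (Fin d)))
    (X := fun z => ‖z‖ ^ 2) (d * u ^ 2) (by linarith : t ≤ 0)
    (integrable_exp_mul_norm_sq_stdGaussian d (by linarith))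
  refine h.trans (le_of_eq ?_)
  rw [mgf_norm_sq_stdGaussian d (by linarith), ← Real.exp_add,
    show 1 - 2 * t = (u ^ 2)⁻¹ by rw [ht]; ring, Real.log_inv, Real.log_pow, ht]
  congr 1
  push_cast
  field_simp
  ring

/-- By symmetry the difference has the law of the sum, whose characteristic function is `exp (-‖t‖²
/ 2)` squared. -/
lemma map_sub_stdGaussian_prod (d : ℕ) :
    ((stdGaussian (EuclideanSpace ℝ (Fin d))).prod (stdGaussian (EuclideanSpace ℝ (Fin d)))).map
      (fun q => q.1 - q.2)
      = (stdGaussian (EuclideanSpace ℝ (Fin d))).map (fun z => Real.sqrt 2 • z) := by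
  have hneg : (stdGaussian (EuclideanSpace ℝ (Fin d))).map (fun z => -z)
      = stdGaussian (EuclideanSpace ℝ (Fin d)) :=
    stdGaussian_map (LinearIsometryEquiv.neg ℝ)
  have h1 : ((stdGaussian (EuclideanSpace ℝ (Fin d))).prod
      (stdGaussian (EuclideanSpace ℝ (Fin d)))).map (fun q => q.1 - q.2)
      = ((stdGaussian (EuclideanSpace ℝ (Fin d))).prod
      (stdGaussian (EuclideanSpace ℝ (Fin d)))).map (fun q => q.1 + q.2) := by
    conv_rhs => rw [← hneg]
    conv_rhs => enter [2, 1]; rw [hneg, ← Measure.map_id (μ := stdGaussian _)]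
    rw [Measure.map_prod_map _ _ (by fun_prop) (by fun_prop),
      Measure.map_map (by fun_prop) (by fun_prop)]
    simp [Function.comp_def, sub_eq_add_neg]
  rw [h1]
  have : IsProbabilityMeasure ((stdGaussian (EuclideanSpace ℝ (Fin d))).map
      (fun z => Real.sqrt 2 • z)) := Measure.isProbabilityMeasure_map (by fun_prop)
  refine Measure.ext_of_charFun ?_
  ext t
  rw [charFun_map_smul, charFun_map_add_prod_eq_mul, Pi.mul_apply, charFun_stdGaussian, charFun_stdGaussian,
    ← Complex.exp_add, norm_smul]
  congr 1
  have : ‖Real.sqrt 2‖ ^ 2 = 2 := by simp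
  push_cast
  rw [mul_pow, ← Complex.ofReal_pow ‖Real.sqrt 2‖, this]
  push_cast
  ring

lemma stdGaussian_prod_real_dist (d : ℕ) {S : Set ℝ} (hS : MeasurableSet S) :
    ((stdGaussian (EuclideanSpace ℝ (Fin d))).prod (stdGaussian (EuclideanSpace ℝ (Fin d)))).real
      {q | dist q.1 q.2 ∈ S}
      = (stdGaussian (EuclideanSpace ℝ (Fin d))).real {z | Real.sqrt 2 * ‖z‖ ∈ S} := by
  have h := map_sub_stdGaussian_prod d
  have hS' : MeasurableSet {z : EuclideanSpace ℝ (Fin d) | ‖z‖ ∈ S} := measurable_norm hS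
  have h2 := congrArg (fun μ => μ.real {z : EuclideanSpace ℝ (Fin d) | ‖z‖ ∈ S}) h
  simp only at h2
  rw [map_measureReal_apply (by fun_prop) hS', map_measureReal_apply (by fun_prop) hS'] at h2
  simpa [dist_eq_norm, norm_smul, abs_of_nonneg] using h2

lemma upperDist_sq (d : ℕ) {η : ℝ} (hη : 0 ≤ η) :
    upperDist η d ^ 2 = 2 * (d + 2 * Real.sqrt (d * η) + 2 * η) := by
  rw [upperDist, mul_pow, Real.sq_sqrt (by norm_num), Real.sq_sqrt (by positivity)]

lemma upperDist_nonneg (η : ℝ) (d : ℕ) : 0 ≤ upperDist η d := by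
  unfold upperDist; positivity

lemma upperDist_mono (d : ℕ) {β η : ℝ} (h : β ≤ η) : upperDist β d ≤ upperDist η d := by
  unfold upperDist
  gcongr

/-- Enlarging `U` by `2 a` is at least as good as enlarging `√η` by `a`. -/
lemma upperDist_sq_le_upperDist_add {d : ℕ} {η a : ℝ} (hη : 0 ≤ η) (ha : 0 ≤ a) :
    upperDist ((Real.sqrt η + a) ^ 2) d ≤ upperDist η d + 2 * a := by
  have h0 := upperDist_nonneg η d
  refine le_of_sq_le_sq ?_ (by positivity)
  have hs (x : ℝ) : Real.sqrt (d * x) = Real.sqrt d * Real.sqrt x :=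
    Real.sqrt_mul (Nat.cast_nonneg d) _
  have h1 := upperDist_sq d hη
  rw [upperDist_sq d (by positivity), hs, Real.sqrt_sq (by positivity)]
  rw [hs] at h1
  have hd := Real.sq_sqrt (Nat.cast_nonneg (α := ℝ) d)
  have he := Real.sq_sqrt hη
  have hdn := Real.sqrt_nonneg (d : ℝ)
  have hen := Real.sqrt_nonneg η
  -- After squaring, the two sides of the goal differ exactly by `4 * a` times the gap in this
  -- inequality.
  have h2 : Real.sqrt d + 2 * Real.sqrt η ≤ upperDist η d := by
    refine le_of_sq_le_sq ?_ h0
    nlinarith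
  nlinarith [mul_le_mul_of_nonneg_left h2 ha]

lemma stdGaussian_prod_real_upperDist_lt {d : ℕ} (hd : 0 < d) {η a : ℝ} (hη : 0 ≤ η)
    (ha : 0 ≤ a) :
    ((stdGaussian (EuclideanSpace ℝ (Fin d))).prod (stdGaussian (EuclideanSpace ℝ (Fin d)))).real
      {q | upperDist η d + 2 * a < dist q.1 q.2} ≤ Real.exp (-(Real.sqrt η + a) ^ 2) := by
  have h := stdGaussian_prod_real_dist d (measurableSet_Ioi (a := upperDist η d + 2 * a))
  simp only [Set.mem_Ioi] at h
  rw [h]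
  refine le_trans (measureReal_mono ?_)
    (stdGaussian_real_le_norm_sq hd (η := (Real.sqrt η + a) ^ 2) (by positivity))
  intro z hz
  simp only [Set.mem_ofPred_eq] at hz ⊢
  have h1 := (upperDist_sq_le_upperDist_add (d := d) hη ha).trans hz.le
  have h2 := pow_le_pow_left₀ (upperDist_nonneg _ _) h1 2
  rw [upperDist_sq d (by positivity), mul_pow, Real.sq_sqrt (by norm_num)] at h2
  linarith

/-- In units of `√(2d)` the threshold is `u = v - w`. The rate `(u² - 1) / 2 - log u` is bounded
below by splitting `log u = log v + log (1 - w / v)`: the first logarithm yields `(1 - v²)² / 4 = η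
/ d`; the linear term `w / v` of the second absorbs `-w v`, and the quadratic terms give `w² = γ² /
(2d)`. -/
lemma stdGaussian_prod_real_lt_lowerDist {d : ℕ} (hd : 0 < d) {η γ : ℝ} (hη : 0 ≤ η)
    (hγ : 0 ≤ γ) (hL : γ < lowerDist η d) :
    ((stdGaussian (EuclideanSpace ℝ (Fin d))).prod (stdGaussian (EuclideanSpace ℝ (Fin d)))).real
      {q | dist q.1 q.2 < lowerDist η d - γ} ≤ Real.exp (-(η + γ ^ 2 / 2)) := by
  have hd' : (0 : ℝ) < d := by exact_mod_cast hd
  have hL0 : 0 < lowerDist η d := hγ.trans_lt hL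
  have hpos : 0 < d - 2 * Real.sqrt (d * η) := by
    by_contra hcon
    rw [lowerDist, Real.sqrt_eq_zero_of_nonpos (not_lt.1 hcon), mul_zero] at hL0
    exact lt_irrefl _ hL0
  have hLsq : lowerDist η d ^ 2 = 2 * (d - 2 * Real.sqrt (d * η)) := by
    rw [lowerDist, mul_pow, Real.sq_sqrt (by norm_num), Real.sq_sqrt hpos.le]
  have hs : Real.sqrt (d * η) ^ 2 = d * η := Real.sq_sqrt (by positivity)
  have hs0 := Real.sqrt_nonneg (d * η)
  set q := Real.sqrt (2 * d) with hq
  have hq0 : 0 < q := Real.sqrt_pos.2 (by positivity)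
  have hq2 : q ^ 2 = 2 * d := Real.sq_sqrt (by positivity)
  set v := lowerDist η d / q with hv
  set w := γ / q with hw
  have hv0 : 0 < v := by positivity
  have hw0 : 0 ≤ w := by positivity
  have hwv : w < v := by rw [hv, hw]; gcongr
  have hv2 : v ^ 2 = 1 - 2 * Real.sqrt (d * η) / d := by
    rw [hv, div_pow, hq2, hLsq]; field_simp
  have hw2 : d * w ^ 2 = γ ^ 2 / 2 := by rw [hw, div_pow, hq2]; field_simp
  have hv1 : v ^ 2 ≤ 1 := by rw [hv2]; have : 0 ≤ 2 * Real.sqrt (d * η) / d := by positivity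
                             linarith
  have hv1' : v ≤ 1 := by nlinarith
  have h := stdGaussian_prod_real_dist d (measurableSet_Iio (a := lowerDist η d - γ))
  simp only [Set.mem_Iio] at h
  rw [h]
  refine le_trans (measureReal_mono ?_)
    ((stdGaussian_real_norm_sq_le d (u := v - w) (by linarith) (by linarith)).trans ?_)
  · intro z hz
    simp only [Set.mem_ofPred_eq] at hz ⊢
    have h1 := pow_le_pow_left₀ (by positivity) hz.le 2
    have h2 : lowerDist η d - γ = q * (v - w) := by rw [hv, hw]; field_simp
    rw [h2, mul_pow, mul_pow, hq2, Real.sq_sqrt (by norm_num)] at h1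
    linarith
  · rw [Real.exp_le_exp, neg_le_neg_iff]
    have hx1 : w / v < 1 := (div_lt_one hv0).2 hwv
    have h3 := add_sq_div_two_le_neg_log_one_sub (x := w / v) (by positivity) hx1
    have h4 := add_sq_div_two_le_neg_log_one_sub (x := 1 - v ^ 2) (by linarith) (by nlinarith)
    rw [sub_sub_cancel, Real.log_pow] at h4
    have h5 : Real.log (v - w) = Real.log v + Real.log (1 - w / v) := by
      rw [← Real.log_mul hv0.ne' (by linarith)]
      congr 1
      field_simp
    push_cast at h4
    have h6 : d * (1 - v ^ 2) ^ 2 / 4 = η := by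
      rw [hv2]; field_simp; nlinarith
    have h7 : w * v ≤ w / v := by rw [le_div_iff₀ hv0]; nlinarith
    have h8 : w ^ 2 ≤ (w / v) ^ 2 := by
      gcongr
      rw [le_div_iff₀ hv0]; nlinarith
    have h9 : (1 - v ^ 2) ^ 2 / 4 + w ^ 2 ≤ ((v - w) ^ 2 - 1) / 2 - Real.log (v - w) := by
      have h10 : (v - w) ^ 2 = v ^ 2 - 2 * (w * v) + w ^ 2 := by ring
      rw [h5, h10]
      linarith
    calc η + γ ^ 2 / 2 = d * ((1 - v ^ 2) ^ 2 / 4 + w ^ 2) := by rw [← hw2, ← h6]; ring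
      _ ≤ _ := by gcongr

end GaussianTails

/-! ### The final state of a cell and the law of its last hop. -/

section Hops

/-- The hop sequences whose last hop is to the stream point `t`. -/
def lastHop {n : ℕ} (t : Fin n) : Set (Fin n → Bool) :=
  {h | h t = true ∧ ∀ s, t < s → h s = false}

open Classical in
-- The hop at `t` erases everything before it. The point `x t` itself is counted, hence `t ≤ s`.
lemma cellRun_of_mem_lastHop {X : Type*} [PseudoEMetricSpace X] (r : ℝ≥0∞) {n : ℕ}
    (x : Fin n → X) {t : Fin n} {h : Fin n → Bool} (hh : h ∈ lastHop t) :
    cellRun r n x h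
      = some (x t, (Finset.univ.filter fun s => t ≤ s ∧ edist (x t) (x s) ≤ r).card) := by
  induction n with
  | zero => exact t.elim0
  | succ n ih =>
    obtain ⟨h1, h2⟩ := hh
    induction t using Fin.lastCases with
    | last =>
      have hcard : (Finset.univ.filter fun s =>
          Fin.last n ≤ s ∧ edist (x (Fin.last n)) (x s) ≤ r) = {Fin.last n} := by
        ext s
        simp only [Finset.mem_filter, Finset.mem_univ, true_and, Finset.mem_singleton,
          Fin.last_le_iff]
        constructor
        · exact fun hs => hs.1
        · rintro rfl
          simp
      rw [cellRun, hcard]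
      simp [cellStep, h1]
    | cast t =>
      have hlast : h (Fin.last n) = false := h2 _ (Fin.castSucc_lt_last t)
      have ih' := ih (fun t => x t.castSucc) (t := t) (h := fun t => h t.castSucc)
        ⟨h1, fun s hs => h2 _ (Fin.castSucc_lt_castSucc_iff.2 hs)⟩
      rw [cellRun, ih', hlast]
      simp only [cellStep, Option.map_some, Bool.false_eq_true, if_false, Option.some.injEq,
        Prod.mk.injEq, true_and]
      rw [Finset.card_filter, Finset.card_filter, Fin.sum_univ_castSucc]
      simp only [Fin.castSucc_le_castSucc_iff, Fin.le_last, true_and]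
      split_ifs <;> rfl

/-- The product telescopes: the factors after `t` are `s / (s + 1)`. -/
lemma prod_hop_eq {n : ℕ} (t : Fin n) :
    ∏ s : Fin n, (if s < t then 1 else if s = t then 1 / ((s : ℝ) + 1) else
      1 - 1 / ((s : ℝ) + 1)) = 1 / n := by
  induction n with
  | zero => exact t.elim0
  | succ n ih =>
    rw [Fin.prod_univ_castSucc]
    induction t using Fin.lastCases with
    | last => simp [Fin.castSucc_lt_last]
    | cast t =>
      have hn : (n : ℝ) ≠ 0 := by
        have := t.pos
        positivity
      have h1 : ¬ Fin.last n < t.castSucc := (Fin.castSucc_lt_last t).not_gt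
      have h2 : ¬ Fin.last n = t.castSucc := (Fin.castSucc_lt_last t).ne'
      simp only [Fin.castSucc_lt_castSucc_iff, Fin.castSucc_inj, Fin.val_castSucc, h1, h2,
        if_false, Fin.val_last]
      rw [ih t]
      push_cast
      field_simp
      ring

lemma pi_bernoulli_real_lastHop {n : ℕ} (t : Fin n) :
    (Measure.pi fun t : Fin n => bernoulliMeasure true false (hopProb t)).real (lastHop t)
      = 1 / n := by
  have h : lastHop t = Set.univ.pi fun s =>
      if s < t then Set.univ else if s = t then {true} else {false} := by
    ext h
    simp only [lastHop, Set.mem_ofPred_eq, Set.mem_univ_pi]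
    constructor
    · rintro ⟨h1, h2⟩ s
      split_ifs with h3 h4
      · trivial
      · simp [h4, h1]
      · simp [h2 s (lt_of_le_of_ne (not_lt.1 h3) (Ne.symm h4))]
    · refine fun h1 => ⟨by simpa using h1 t, fun s hs => ?_⟩
      simpa [hs.not_gt, hs.ne'] using h1 s
  rw [h, measureReal_def, Measure.pi_pi, ENNReal.toReal_prod, ← prod_hop_eq t]
  refine Finset.prod_congr rfl fun s _ => ?_
  rw [← measureReal_def]
  split_ifs with h3 h4
  · simp
  · rw [bernoulliMeasure_real_apply_of_mem_of_notMem _ (by simp) (by simp) (by simp)]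
    simp [hopProb]
  · rw [bernoulliMeasure_real_apply_of_notMem_of_mem _ (by simp) (by simp) (by simp)]
    simp [hopProb]

lemma disjoint_lastHop {n : ℕ} {s t : Fin n} (h : s ≠ t) : Disjoint (lastHop s) (lastHop t) := by
  rw [Set.disjoint_left]
  rintro g ⟨h1, h2⟩ ⟨h3, h4⟩
  rcases lt_or_gt_of_ne h with h5 | h5
  · simpa [h3] using h2 _ h5
  · simpa [h1] using h4 _ h5

/-- The probability that no cell ends up at a point of `C`. -/
lemma hopLaw_real_miss (m : ℕ) {n : ℕ} (C : Finset (Fin n)) :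
    (hopLaw m n).real {h | ∀ i, ∀ t ∈ C, h i ∉ lastHop t} = (1 - (C.card : ℝ) / n) ^ m := by
  have h : {h : Fin m → Fin n → Bool | ∀ i, ∀ t ∈ C, h i ∉ lastHop t}
      = Set.univ.pi fun _ => (⋃ t ∈ C, lastHop t)ᶜ := by
    ext h
    simp
  rw [h, hopLaw, measureReal_def, Measure.pi_pi, ENNReal.toReal_prod]
  simp only [← measureReal_def]
  rw [Finset.prod_const, Finset.card_univ, Fintype.card_fin,
    probReal_compl_eq_one_sub (Set.toFinite _).measurableSet,
    measureReal_biUnion_finset (fun s _ t _ hst => disjoint_lastHop hst)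
      (fun _ _ => (Set.toFinite _).measurableSet)]
  simp_rw [pi_bernoulli_real_lastHop]
  rw [Finset.sum_const, nsmul_eq_mul, mul_one_div]

/-- If all but some points of `F` are in `C`, then missing `C` is at most as likely as missing `F`,
up to the proportion of the exceptional points. -/
lemma hopLaw_real_miss_le (m : ℕ) {n : ℕ} (C F : Finset (Fin n)) (hF : F.Nonempty) :
    (hopLaw m n).real {h | ∀ i, ∀ t ∈ C, h i ∉ lastHop t}
      ≤ (1 - (F.card : ℝ) / n) ^ m + ((F \ C).card : ℝ) / F.card := by
  rw [hopLaw_real_miss]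
  have hn : (0 : ℝ) < n := by
    obtain ⟨t, _⟩ := hF
    have := t.pos
    exact_mod_cast this
  have hF0 : (0 : ℝ) < F.card := by exact_mod_cast hF.card_pos
  have hCn : (C.card : ℝ) ≤ n := by
    exact_mod_cast (Finset.card_le_univ C).trans_eq (Fintype.card_fin n)
  have hFn : (F.card : ℝ) ≤ n := by
    exact_mod_cast (Finset.card_le_univ F).trans_eq (Fintype.card_fin n)
  set q := ((F \ C).card : ℝ) / F.card with hq
  have hq0 : 0 ≤ q := by positivity
  have hq1 : q ≤ 1 := by
    rw [hq, div_le_one hF0]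
    exact_mod_cast Finset.card_le_card Finset.sdiff_subset
  have hb : (F.card : ℝ) ≤ (F \ C).card + C.card := by
    have : F.card ≤ (F \ C).card + C.card := by
      rw [Finset.card_sdiff_add_card]
      exact Finset.card_le_card Finset.subset_union_left
    exact_mod_cast this
  have ha : 0 ≤ 1 - (F.card : ℝ) / n := by
    rw [sub_nonneg, div_le_one hn]; exact hFn
  have hle : 1 - (C.card : ℝ) / n ≤ (1 - q) * (1 - (F.card : ℝ) / n) + q * 1 := by
    have : (1 - q) * (1 - (F.card : ℝ) / n) + q * 1
        = 1 - (F.card : ℝ) / n + (F \ C).card / n := by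
      rw [hq]; field_simp; ring
    rw [this, sub_add, ← sub_div]
    gcongr
    linarith
  have hC0 : 0 ≤ 1 - (C.card : ℝ) / n := by
    rw [sub_nonneg, div_le_one hn]; exact hCn
  -- The miss probability of one cell is at most a mixture, with weight `q` on `1`, of `1` and the
  -- miss probability of `F`; convexity of the power `m` keeps the weights.
  have hconv := (convexOn_pow m).2 (Set.mem_Ici.2 ha) (Set.mem_Ici.2 zero_le_one)
    (sub_nonneg.2 hq1) hq0 (by ring)
  simp only [smul_eq_mul, one_pow] at hconv
  calc (1 - (C.card : ℝ) / n) ^ m ≤ ((1 - q) * (1 - (F.card : ℝ) / n) + q * 1) ^ m :=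
        pow_le_pow_left₀ hC0 hle m
    _ ≤ (1 - q) * (1 - (F.card : ℝ) / n) ^ m + q * 1 := hconv
    _ ≤ _ := by
        have := mul_nonneg hq0 (pow_nonneg ha m)
        linarith

/-- With the prescribed number of cells, a set of `ε f n` indices is missed with probability at most
`f δ`. -/
lemma pow_memorySize_le {f ε δ : ℝ} (hf : 0 < f) (hε : 0 < ε) (hδ : 0 < δ) {a : ℝ} (ha : f * ε ≤ a) (ha1 : a ≤ 1) :
    (1 - a) ^ memorySize f ε δ ≤ f * δ := by
  have hfδ : 0 < f * δ := by positivity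
  have hm : Real.log (1 / (f * δ)) ≤ f * ε * memorySize f ε δ := by
    have := Nat.le_ceil (Real.log (1 / (f * δ)) / (f * ε))
    rw [div_le_iff₀ (by positivity)] at this
    rw [memorySize]
    linarith
  calc (1 - a) ^ memorySize f ε δ ≤ Real.exp (-a) ^ memorySize f ε δ :=
        pow_le_pow_left₀ (by linarith) (Real.one_sub_le_exp_neg a) _
    _ = Real.exp (-(a * memorySize f ε δ)) := by rw [← Real.exp_nat_mul]; congr 1; ring
    _ ≤ Real.exp (-Real.log (1 / (f * δ))) := by
        rw [Real.exp_le_exp, neg_le_neg_iff]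
        exact hm.trans (by gcongr)
    _ = f * δ := by rw [one_div, Real.log_inv, neg_neg, Real.exp_log hfδ]

end Hops

/-! ### Separating data from hops; Markov's inequality. -/

section Data

/-- A point and the data, seen from the means of their Gaussians. -/
abbrev DataSpace (d n : ℕ) : Type :=
  EuclideanSpace ℝ (Fin d) × (Fin n → EuclideanSpace ℝ (Fin d))

/-- The law of the point and the data. -/
def dataLaw (d n : ℕ) : Measure (DataSpace d n) :=
  (stdGaussian (EuclideanSpace ℝ (Fin d))).prod
    (Measure.pi fun _ => stdGaussian (EuclideanSpace ℝ (Fin d)))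

instance (d n : ℕ) : IsProbabilityMeasure (dataLaw d n) := by
  unfold dataLaw; infer_instance

instance (m n : ℕ) : IsProbabilityMeasure (hopLaw m n) := by
  unfold hopLaw; infer_instance

instance (d n m : ℕ) : IsProbabilityMeasure (law d n m) := by
  unfold law; infer_instance

lemma measurePreserving_prodAssoc_law (d n m : ℕ) :
    MeasurePreserving MeasurableEquiv.prodAssoc ((dataLaw d n).prod (hopLaw m n)) (law d n m) :=
  measurePreserving_prodAssoc _ _ _

lemma law_real_data (d n m : ℕ) {A : Set (DataSpace d n)} (hA : MeasurableSet A) :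
    (law d n m).real {ω | (ω.1, ω.2.1) ∈ A} = (dataLaw d n).real A := by
  have hm : Measurable fun ω : Sample d n m => (ω.1, ω.2.1) := by fun_prop
  have hA' : MeasurableSet {ω : Sample d n m | (ω.1, ω.2.1) ∈ A} := hm hA
  rw [← (measurePreserving_prodAssoc_law d n m).measureReal_preimage hA'.nullMeasurableSet]
  have : (MeasurableEquiv.prodAssoc ⁻¹' {ω : Sample d n m | (ω.1, ω.2.1) ∈ A} :
      Set (DataSpace d n × (Fin m → Fin n → Bool))) = A ×ˢ Set.univ := by
    ext ω
    simp [MeasurableEquiv.prodAssoc]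
  rw [this, measureReal_prod_prod]
  simp

lemma dataLaw_real_dist_point {d n : ℕ} (t : Fin n) {T : Set ℝ} (hT : MeasurableSet T) :
    (dataLaw d n).real {ω | dist ω.1 (ω.2 t) ∈ T}
      = ((stdGaussian (EuclideanSpace ℝ (Fin d))).prod
          (stdGaussian (EuclideanSpace ℝ (Fin d)))).real {q | dist q.1 q.2 ∈ T} := by
  have h : MeasurePreserving (Prod.map id (Function.eval t)) (dataLaw d n)
      ((stdGaussian (EuclideanSpace ℝ (Fin d))).prod
          (stdGaussian (EuclideanSpace ℝ (Fin d)))) :=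
    (MeasurePreserving.id _).prod (measurePreserving_eval _ t)
  have hT' : MeasurableSet {q : EuclideanSpace ℝ (Fin d) × EuclideanSpace ℝ (Fin d) |
      dist q.1 q.2 ∈ T} := measurable_dist hT
  rw [← h.measureReal_preimage hT'.nullMeasurableSet]
  rfl

lemma dataLaw_real_dist_data {d n : ℕ} {s t : Fin n} (hst : s ≠ t) {T : Set ℝ}
    (hT : MeasurableSet T) :
    (dataLaw d n).real {ω | dist (ω.2 s) (ω.2 t) ∈ T}
      = ((stdGaussian (EuclideanSpace ℝ (Fin d))).prod
          (stdGaussian (EuclideanSpace ℝ (Fin d)))).real {q | dist q.1 q.2 ∈ T} := by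
  have h1 : MeasurePreserving (fun x : Fin n → EuclideanSpace ℝ (Fin d) => (x s, x t))
      (Measure.pi fun _ => stdGaussian (EuclideanSpace ℝ (Fin d)))
      ((stdGaussian (EuclideanSpace ℝ (Fin d))).prod
          (stdGaussian (EuclideanSpace ℝ (Fin d)))) := by
    refine ⟨by fun_prop, ?_⟩
    have h := (iIndepFun_pi (μ := fun _ : Fin n => stdGaussian (EuclideanSpace ℝ (Fin d)))
      (X := fun _ z => z) (fun _ => aemeasurable_id)).indepFun hst
    rw [indepFun_iff_map_prod_eq_prod_map_map (measurable_pi_apply s).aemeasurable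
      (measurable_pi_apply t).aemeasurable] at h
    rw [h]
    congr 1
    · exact (measurePreserving_eval
        (fun _ : Fin n => stdGaussian (EuclideanSpace ℝ (Fin d))) s).map_eq
    · exact (measurePreserving_eval
        (fun _ : Fin n => stdGaussian (EuclideanSpace ℝ (Fin d))) t).map_eq
  have h : MeasurePreserving (fun ω : DataSpace d n => (ω.2 s, ω.2 t)) (dataLaw d n)
      ((stdGaussian (EuclideanSpace ℝ (Fin d))).prod
          (stdGaussian (EuclideanSpace ℝ (Fin d)))) :=
    h1.comp measurePreserving_snd
  have hT' : MeasurableSet {q : EuclideanSpace ℝ (Fin d) × EuclideanSpace ℝ (Fin d) |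
      dist q.1 q.2 ∈ T} := measurable_dist hT
  rw [← h.measureReal_preimage hT'.nullMeasurableSet]
  rfl

open Classical in
/-- Markov's inequality for the number of events that occur. -/
lemma real_le_card_filter_le {Ω ι : Type*} [MeasurableSpace Ω] (μ : Measure Ω)
    [IsProbabilityMeasure μ] (S : Finset ι) (A : ι → Set Ω) (hA : ∀ i, MeasurableSet (A i))
    {q a : ℝ} (hq : ∀ i ∈ S, μ.real (A i) ≤ q) (ha : 0 < a) :
    μ.real {ω | a ≤ ((S.filter fun i => ω ∈ A i).card : ℝ)} ≤ S.card * q / a := by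
  have hc (ω : Ω) : ((S.filter fun i => ω ∈ A i).card : ℝ)
      = ∑ i ∈ S, (A i).indicator (fun _ => (1 : ℝ)) ω := by
    rw [Finset.card_filter]
    push_cast
    exact Finset.sum_congr rfl fun i _ => by simp [Set.indicator_apply]
  simp_rw [hc]
  have hint (i : ι) : Integrable ((A i).indicator (fun _ => (1 : ℝ))) μ :=
    (integrable_const 1).indicator (hA i)
  have h := mul_meas_ge_le_integral_of_nonneg (μ := μ)
    (f := fun ω => ∑ i ∈ S, (A i).indicator (fun _ => (1 : ℝ)) ω)
    (ae_of_all _ fun ω => Finset.sum_nonneg fun i _ =>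
      Set.indicator_nonneg (fun _ _ => zero_le_one) _)
    (integrable_finsetSum _ fun i _ => hint i) a
  rw [integral_finsetSum _ fun i _ => hint i] at h
  simp_rw [integral_indicator_const (1 : ℝ) (hA _), smul_eq_mul, mul_one] at h
  rw [le_div_iff₀ ha, mul_comm]
  refine h.trans ((Finset.sum_le_sum hq).trans ?_)
  rw [Finset.sum_const, nsmul_eq_mul]

/-- The probability that all cells miss the good points of `F`. -/
lemma law_real_miss_le {d n m : ℕ} (F : Finset (Fin n)) (hF : F.Nonempty)
    {A : Set (DataSpace d n)} (hA : MeasurableSet A)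
    {good : Fin n → Set (DataSpace d n)} (hgood : ∀ t, MeasurableSet (good t))
    {a b : ℝ} (ha : (1 - (F.card : ℝ) / n) ^ m ≤ a)
    (hb : ∀ t ∈ F, (dataLaw d n).real (good t)ᶜ ≤ b) :
    (law d n m).real {ω | (ω.1, ω.2.1) ∈ A ∧
        ∀ i, ∀ t ∈ F, (ω.1, ω.2.1) ∈ good t → ω.2.2 i ∉ lastHop t}
      ≤ a * (dataLaw d n).real A + b := by
  classical
  have hF0 : (0 : ℝ) < F.card := by exact_mod_cast hF.card_pos
  have hm : Measurable fun ω : Sample d n m => (ω.1, ω.2.1) := by fun_prop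
  set T : Set (Sample d n m) := {ω | (ω.1, ω.2.1) ∈ A ∧
        ∀ i, ∀ t ∈ F, (ω.1, ω.2.1) ∈ good t → ω.2.2 i ∉ lastHop t} with hT
  have hTm : MeasurableSet T := by
    have h1 : T = {ω | (ω.1, ω.2.1) ∈ A} ∩ ⋂ i, ⋂ t ∈ F,
        ({ω | (ω.1, ω.2.1) ∈ good t}ᶜ ∪ {ω | ω.2.2 i ∉ lastHop t}) := by
      ext ω
      simp [hT, imp_iff_not_or]
    rw [h1]
    refine (hm hA).inter (MeasurableSet.iInter fun i => Finset.measurableSet_biInter _ fun t _ => ?_)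
    refine (hm (hgood t)).compl.union ?_
    have h2 : Measurable fun ω : Sample d n m => ω.2.2 i := by fun_prop
    exact h2 (Set.toFinite (lastHop t)ᶜ).measurableSet
  -- Bound for the hop probability at fixed data. The slice is empty off `A`, so `a` keeps the
  -- factor `P(A)`, which cancels on conditioning.
  set g : DataSpace d n → ℝ := fun ω => A.indicator (fun _ => a) ω
      + ∑ t ∈ F, ((good t)ᶜ).indicator (fun _ => (1 : ℝ) / F.card) ω with hg
  have hint1 : Integrable (A.indicator fun _ => a) (dataLaw d n) :=
    (integrable_const a).indicator hA
  have hint2 (t : Fin n) : Integrable (((good t)ᶜ).indicator fun _ => (1 : ℝ) / F.card)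
      (dataLaw d n) := (integrable_const _).indicator (hgood t).compl
  have hgint : Integrable g (dataLaw d n) :=
    hint1.add (integrable_finsetSum _ fun t _ => hint2 t)
  rw [← (measurePreserving_prodAssoc_law d n m).measureReal_preimage hTm.nullMeasurableSet]
  set T' : Set (DataSpace d n × (Fin m → Fin n → Bool)) := MeasurableEquiv.prodAssoc ⁻¹' T with hT'
  have hTm' : MeasurableSet T' := MeasurableEquiv.prodAssoc.measurable hTm
  have hslice (ω : DataSpace d n) : (hopLaw m n).real (Prod.mk ω ⁻¹' T') ≤ g ω := by
    by_cases hω : ω ∈ A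
    · have h1 := hopLaw_real_miss_le m (F.filter fun t => ω ∈ good t) F hF
      have h2 : Prod.mk ω ⁻¹' T' = {h | ∀ i, ∀ t ∈ F.filter fun t => ω ∈ good t,
          h i ∉ lastHop t} := by
        ext h
        simp [hT', hT, MeasurableEquiv.prodAssoc, hω]
      rw [h2]
      refine h1.trans ?_
      have h3 : ((F \ F.filter fun t => ω ∈ good t).card : ℝ) / F.card
          = ∑ t ∈ F, ((good t)ᶜ).indicator (fun _ => (1 : ℝ) / F.card) ω := by
        rw [← Finset.filter_not, Finset.card_filter]
        push_cast
        rw [Finset.sum_div]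
        refine Finset.sum_congr rfl fun t _ => ?_
        by_cases ht : ω ∈ good t <;> simp [ht]
      rw [h3, hg]
      simp only [Set.indicator_of_mem hω]
      gcongr
    · have h2 : Prod.mk ω ⁻¹' T' = ∅ := by
        ext h
        simp [hT', hT, MeasurableEquiv.prodAssoc, hω]
      rw [h2, measureReal_empty, hg]
      simp only [Set.indicator_of_notMem hω, zero_add]
      exact Finset.sum_nonneg fun t _ => Set.indicator_nonneg (fun _ _ => by positivity) _
  have hmain : ((dataLaw d n).prod (hopLaw m n)).real T' ≤ ∫ ω, g ω ∂(dataLaw d n) := by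
    rw [measureReal_def, Measure.prod_apply hTm', ← integral_toReal]
    · refine integral_mono_of_nonneg (ae_of_all _ fun ω => ENNReal.toReal_nonneg) hgint
        (ae_of_all _ fun ω => hslice ω)
    · exact (measurable_measure_prodMk_left hTm').aemeasurable
    · exact ae_of_all _ fun ω => measure_lt_top _ _
  refine hmain.trans ?_
  rw [hg, integral_add hint1 (integrable_finsetSum _ fun t _ => hint2 t),
    integral_finsetSum _ fun t _ => hint2 t, integral_indicator_const _ hA]
  simp_rw [integral_indicator_const _ (hgood _).compl, smul_eq_mul]
  rw [mul_comm a]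
  gcongr
  rw [← Finset.sum_mul, mul_one_div, div_le_iff₀ hF0]
  refine (Finset.sum_le_sum hb).trans (le_of_eq ?_)
  rw [Finset.sum_const, nsmul_eq_mul, mul_comm]

end Data

/-! ### The density radius is attained. -/

section Density

/-- There are finitely many distances, so the ball count is constant from `r` up to the next larger
distance. At `r = ⊤` there is no room above, and the equivalence can fail. -/
lemma densityRadius_le_iff {X : Type*} [PseudoEMetricSpace X] {n : ℕ} {x : Fin n → X} {f : ℝ}
    {p : X} {r : ℝ≥0∞} (hr : r ≠ ⊤) : densityRadius x f p ≤ r ↔ IsDense x r f p := by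
  refine ⟨fun h => ?_, fun h => sInf_le h⟩
  have h1 : ∃ ρ, r < ρ ∧ ∀ t, r < edist p (x t) → ρ ≤ edist p (x t) := by
    by_cases hne : (Finset.univ.filter fun t => r < edist p (x t)).Nonempty
    · obtain ⟨t, ht, hmin⟩ := Finset.exists_min_image _ (fun t => edist p (x t)) hne
      exact ⟨edist p (x t), by simpa using ht, fun s hs => hmin s (by simpa using hs)⟩
    · refine ⟨⊤, hr.lt_top, fun t ht => (hne ⟨t, by simpa using ht⟩).elim⟩
  obtain ⟨ρ, hρ, hρt⟩ := h1
  obtain ⟨s, hs, hsρ⟩ := sInf_lt_iff.1 (h.trans_lt hρ)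
  refine le_trans (show IsDense x s f p from hs) ?_
  norm_cast
  refine Finset.card_le_card fun t ht => ?_
  simp only [Finset.mem_filter, Finset.mem_univ, true_and] at ht ⊢
  by_contra hcon
  exact absurd (hρt t (not_le.1 hcon)) (not_le.2 (ht.trans_lt hsρ))

end Density

/-! ### Members of one cluster and the counter of an early member. -/

section Cluster

variable {K d n : ℕ} (lab : Fin n → Fin K) (k : Fin K)

/-- The indices of the data points from the `k`-th Gaussian. -/
def members : Finset (Fin n) := Finset.univ.filter fun t => lab t = k

lemma freq_mul (hn : 0 < n) : freq lab k * n = (members lab k).card := by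
  have : (n : ℝ) ≠ 0 := by positivity
  rw [freq, members]
  field_simp

/-- The number of data points from the `k`-th Gaussian at distance more than `ρ` from `y`. -/
def farCount (x : Fin n → EuclideanSpace ℝ (Fin d)) (y : EuclideanSpace ℝ (Fin d)) (ρ : ℝ) : ℕ :=
  ((members lab k).filter fun s => ρ < dist y (x s)).card

lemma edist_mk_le_iff {i j : Fin K} {y z : EuclideanSpace ℝ (Fin d)} {ρ : ℝ} (hρ : 0 ≤ ρ) :
    edist (⟨i, y⟩ : FarPoint K d) ⟨j, z⟩ ≤ ENNReal.ofReal ρ ↔ i = j ∧ dist y z ≤ ρ := by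
  change (if i = j then edist y z else ⊤) ≤ _ ↔ _
  split_ifs with h
  · simp [h, edist_le_ofReal hρ]
  · simp [h]

lemma ballCount_add_farCount {m : ℕ} (ω : Sample d n m) (y : EuclideanSpace ℝ (Fin d)) {ρ : ℝ}
    (hρ : 0 ≤ ρ) :
    ballCount (stream lab ω) (⟨k, y⟩ : FarPoint K d) (ENNReal.ofReal ρ)
      + farCount lab k ω.2.1 y ρ = (members lab k).card := by
  rw [farCount, ballCount, ← Finset.card_filter_add_card_filter_not (s := members lab k)
    (fun s => dist y (ω.2.1 s) ≤ ρ)]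
  congr 1
  · congr 1
    ext t
    simp [stream, edist_mk_le_iff hρ, members, eq_comm]
  · simp

/-- Take the first `J` elements: the one with index `j ≤ J - 1` has `S.card - j` elements from
itself on. -/
lemma exists_initial_subset {S : Finset (Fin n)} {J : ℕ} (hJ : J ≤ S.card) :
    ∃ F ⊆ S, F.card = J ∧ ∀ t ∈ F, S.card + 1 ≤ (S.filter fun s => t ≤ s).card + J := by
  classical
  set e := S.orderEmbOfFin rfl
  refine ⟨Finset.univ.image fun j : Fin J => e (Fin.castLE hJ j), ?_, ?_, ?_⟩
  · intro t ht
    obtain ⟨j, _, rfl⟩ := Finset.mem_image.1 ht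
    exact S.orderEmbOfFin_mem rfl _
  · exact (Finset.card_image_of_injective _ (e.injective.comp (Fin.castLE_injective hJ))).trans
      (by simp)
  · intro t ht
    obtain ⟨j, _, rfl⟩ := Finset.mem_image.1 ht
    have h : (Finset.Ici (Fin.castLE hJ j)).image e
        ⊆ S.filter fun s => e (Fin.castLE hJ j) ≤ s := by
      intro s hs
      obtain ⟨i, hi, rfl⟩ := Finset.mem_image.1 hs
      simp only [Finset.mem_filter, OrderEmbedding.le_iff_le]
      exact ⟨S.orderEmbOfFin_mem rfl _, Finset.mem_Ici.1 hi⟩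
    have h2 := Finset.card_le_card h
    rw [Finset.card_image_of_injective _ e.injective, Fin.card_Ici] at h2
    have := j.2
    simp only [Fin.val_castLE] at h2
    omega

open Classical in
/-- If few data points of its Gaussian are far from it, then a point that is early enough in the
stream is an output as soon as it is the last one to which some cell hops. -/
lemma mem_outputs_of_farCount_le {m : ℕ} (ω : Sample d n m) {ρ f ε : ℝ} (hρ : 0 ≤ ρ) {J : ℕ}
    (hJ : (J : ℝ) < ε * (f * n) + 1) {t : Fin n} (ht : t ∈ members lab k)
    (htJ : (members lab k).card + 1 ≤ ((members lab k).filter fun s => t ≤ s).card + J)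
    (hfar : (farCount lab k ω.2.1 (ω.2.1 t) ρ : ℝ) ≤ (members lab k).card - f * n)
    {i : Fin m} (hi : ω.2.2 i ∈ lastHop t) :
    (stream lab ω t, ENNReal.ofReal ρ)
      ∈ outputs (ENNReal.ofReal ρ) f ε (stream (K := K) lab ω) ω.2.2 := by
  have hk : lab t = k := by simpa [members] using ht
  refine ⟨rfl, i, _, cellRun_of_mem_lastHop _ _ hi, ?_⟩
  have h1 : ((members lab k).filter fun s => t ≤ s).card
      ≤ (Finset.univ.filter fun s => t ≤ s ∧
        edist (stream lab ω t) (stream (K := K) lab ω s) ≤ ENNReal.ofReal ρ).card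
        + farCount lab k ω.2.1 (ω.2.1 t) ρ := by
    rw [farCount]
    refine le_trans (Finset.card_le_card ?_) (Finset.card_union_le _ _)
    intro s hs
    simp only [members, Finset.mem_filter, Finset.mem_univ, true_and, Finset.mem_union, stream,
      edist_mk_le_iff hρ, hk] at hs ⊢
    by_cases h : dist (ω.2.1 t) (ω.2.1 s) ≤ ρ
    · exact Or.inl ⟨hs.2, hs.1.symm, h⟩
    · exact Or.inr ⟨hs.1, not_le.1 h⟩
  -- The counter is at least `f n + 1 - J`; the `1` makes up for rounding `ε f n` up to `J`.
  have h2 : ((members lab k).card : ℝ) + 1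
      ≤ (Finset.univ.filter fun s => t ≤ s ∧
        edist (stream lab ω t) (stream (K := K) lab ω s) ≤ ENNReal.ofReal ρ).card
        + farCount lab k ω.2.1 (ω.2.1 t) ρ + J := by
    exact_mod_cast htJ.trans (by omega)
  linarith

end Cluster

/-! ### Gaussian factors as multiples of `κ`. -/

section Constants

variable {c : ℝ}

lemma kappa_pos (hc : 0 < c) : 0 < kappa c := by unfold kappa; positivity

lemma mul_exp_neg_le (s : ℝ) : s * Real.exp (-s) ≤ 3 / 8 := by
  have h1 := Real.add_one_le_exp (s - 1)
  have h2 : Real.exp (s - 1) = Real.exp s * Real.exp (-1) := by rw [← Real.exp_add]; ring_nf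
  have h3 : Real.exp (-1) ≤ 3 / 8 := by
    have := Real.exp_neg_one_lt_d9
    linarith
  have h4 : s ≤ Real.exp s * (3 / 8) := by
    have := mul_le_mul_of_nonneg_left h3 (Real.exp_pos s).le
    linarith
  rw [Real.exp_neg, ← div_eq_mul_inv, div_le_iff₀ (Real.exp_pos s)]
  linarith

lemma exp_eq_kappa (hc : 0 < c) : Real.exp (-c ^ 2 / 4) = kappa c * (c ^ 2 / 4) := by
  unfold kappa
  field_simp

lemma exp_neg_sq_eq (c : ℝ) : Real.exp (-c ^ 2) = Real.exp (-c ^ 2 / 4) ^ 4 := by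
  rw [← Real.exp_nat_mul]
  congr 1
  push_cast
  ring

/-- One factor `exp (-c² / 4)` is `κ c² / 4`; the surplus `c² / 4` is absorbed by another such
factor through `s exp (-s) ≤ 3 / 8`. -/
lemma half_exp_neg_half_sq_le (hc : 0 < c) :
    Real.exp (-(c ^ 2 / 2)) / 2 ≤ 3 / 16 * kappa c := by
  have h := mul_exp_neg_le (c ^ 2 / 4)
  have hk := kappa_pos hc
  have h2 : Real.exp (-(c ^ 2 / 2)) = Real.exp (-c ^ 2 / 4) * Real.exp (-(c ^ 2 / 4)) := by
    rw [← Real.exp_add]; congr 1; ring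
  rw [h2, exp_eq_kappa hc, mul_assoc]
  have := mul_le_mul_of_nonneg_left h hk.le
  linarith

lemma exp_neg_sq_le (hc : 0 < c) : Real.exp (-c ^ 2) ≤ 9 / 64 * kappa c ^ 2 := by
  have h := mul_exp_neg_le (c ^ 2 / 4)
  have h0 : 0 ≤ c ^ 2 / 4 * Real.exp (-(c ^ 2 / 4)) := by positivity
  have h2 := pow_le_pow_left₀ h0 h 2
  have h3 : Real.exp (-c ^ 2)
      = kappa c ^ 2 * (c ^ 2 / 4 * Real.exp (-(c ^ 2 / 4))) ^ 2 := by
    have h4 := exp_eq_kappa hc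
    rw [exp_neg_sq_eq, show Real.exp (-c ^ 2 / 4) ^ 4
      = Real.exp (-c ^ 2 / 4) ^ 2 * Real.exp (-c ^ 2 / 4) ^ 2 by ring]
    nth_rw 1 [h4]
    rw [show -(c ^ 2 / 4) = -c ^ 2 / 4 by ring]
    ring
  rw [h3]
  have := mul_le_mul_of_nonneg_left h2 (sq_nonneg (kappa c))
  linarith

/-- The hypothesis gives `√η ≥ 1 / 2`, so the cross term `c √η` is at least `c / 4 + c / 4`, which
absorbs the `c²` in `exp (-c² / 4) = κ c² / 4`. -/
lemma exp_neg_sqrt_add_sq_le (hc : 0 < c) {η : ℝ} (hη : Real.exp (-η) ≤ 1 / 2) :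
    Real.exp (-(Real.sqrt η + c / 2) ^ 2) ≤ 9 / 32 * kappa c := by
  have hη1 : 1 / 4 ≤ η := by
    by_contra hcon
    have h1 := Real.add_one_le_exp (-η)
    linarith [not_le.1 hcon]
  have hs : 1 / 2 ≤ Real.sqrt η := Real.le_sqrt_of_sq_le (by linarith)
  have hsq : Real.sqrt η ^ 2 = η := Real.sq_sqrt (by linarith)
  have h := mul_exp_neg_le (c / 4)
  have h0 : 0 ≤ c / 4 * Real.exp (-(c / 4)) := by positivity
  have h2 := pow_le_pow_left₀ h0 h 2
  have hk := kappa_pos hc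
  calc Real.exp (-(Real.sqrt η + c / 2) ^ 2)
      ≤ Real.exp (-η + (-(c / 4) + -(c / 4) + -c ^ 2 / 4)) := by
        rw [Real.exp_le_exp]
        nlinarith
    _ = Real.exp (-η) * (kappa c * (4 * (c / 4 * Real.exp (-(c / 4))) ^ 2)) := by
        rw [Real.exp_add, Real.exp_add, Real.exp_add, exp_eq_kappa hc]
        ring
    _ ≤ 1 / 2 * (kappa c * (4 * (3 / 8) ^ 2)) := by gcongr
    _ = 9 / 32 * kappa c := by ring

end Constants

/-! ### Probabilities of many far or many near members. -/

section Counts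

variable {K d n : ℕ} (lab : Fin n → Fin K) (k : Fin K)

lemma measurable_card_filter {Ω ι : Type*} [MeasurableSpace Ω] (S : Finset ι) (p : ι → Ω → Prop)
    [∀ i ω, Decidable (p i ω)] (hp : ∀ i, MeasurableSet {ω | p i ω}) :
    Measurable fun ω => ((S.filter fun i => p i ω).card : ℝ) := by
  simp_rw [Finset.card_filter]
  push_cast
  exact Finset.measurable_sum _ fun i _ => Measurable.ite (hp i) measurable_const measurable_const

lemma measurable_farCount {y : DataSpace d n → EuclideanSpace ℝ (Fin d)} (hy : Measurable y)
    (ρ : ℝ) : Measurable fun ω : DataSpace d n => (farCount lab k ω.2 (y ω) ρ : ℝ) :=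
  measurable_card_filter _ _ fun s => measurableSet_lt measurable_const
    (hy.dist ((measurable_pi_apply s).comp measurable_snd))

lemma exp_neg_sqrt_add_sq_le_exp {β c : ℝ} (hβ : 0 ≤ β) (hc : 0 ≤ c) :
    Real.exp (-(Real.sqrt β + c) ^ 2) ≤ Real.exp (-(β + c ^ 2)) := by
  have := Real.sq_sqrt hβ
  have := mul_nonneg (Real.sqrt_nonneg β) hc
  rw [Real.exp_le_exp]
  nlinarith

lemma dataLaw_real_dist_point_far_le (hd : 0 < d) {η a : ℝ} (hη : 0 ≤ η) (ha : 0 ≤ a)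
    (t : Fin n) :
    (dataLaw d n).real {ω | upperDist η d + 2 * a < dist ω.1 (ω.2 t)}
      ≤ Real.exp (-(Real.sqrt η + a) ^ 2) :=
  (dataLaw_real_dist_point t measurableSet_Ioi).trans_le
    (stdGaussian_prod_real_upperDist_lt hd hη ha)

lemma dataLaw_real_dist_data_far_le (hd : 0 < d) {η a : ℝ} (hη : 0 ≤ η) (ha : 0 ≤ a)
    (s t : Fin n) :
    (dataLaw d n).real {ω | upperDist η d + 2 * a < dist (ω.2 s) (ω.2 t)}
      ≤ Real.exp (-(Real.sqrt η + a) ^ 2) := by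
  by_cases hst : s = t
  · have h0 := upperDist_nonneg η d
    have : {ω : DataSpace d n | upperDist η d + 2 * a < dist (ω.2 s) (ω.2 t)} = ∅ := by
      ext ω
      simp only [hst, dist_self, Set.mem_ofPred_eq, Set.mem_empty_iff_false, iff_false, not_lt]
      positivity
    rw [this, measureReal_empty]
    positivity
  · exact (dataLaw_real_dist_data hst measurableSet_Ioi).trans_le
      (stdGaussian_prod_real_upperDist_lt hd hη ha)

lemma dataLaw_real_farCount_point_le (hd : 0 < d) {c β a : ℝ} (hβ : 0 ≤ β) (hc : 0 ≤ c)
    (ha : 0 < a) :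
    (dataLaw d n).real {ω | a ≤ farCount lab k ω.2 ω.1 (upperDist β d + 2 * c)}
      ≤ (members lab k).card * Real.exp (-(β + c ^ 2)) / a := by
  refine le_trans (measureReal_mono ?_) (real_le_card_filter_le (dataLaw d n) (members lab k)
    (fun s => {ω | upperDist β d + 2 * c < dist ω.1 (ω.2 s)})
    (fun s => measurableSet_lt measurable_const
      (measurable_fst.dist ((measurable_pi_apply s).comp measurable_snd)))
    (fun s _ => (dataLaw_real_dist_point_far_le hd hβ hc s).trans
      (exp_neg_sqrt_add_sq_le_exp hβ hc)) ha)
  intro ω hω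
  simp only [farCount, Set.mem_ofPred_eq] at hω ⊢
  convert hω

lemma dataLaw_real_farCount_data_le (hd : 0 < d) {c β a : ℝ} (hβ : 0 ≤ β) (hc : 0 ≤ c)
    (ha : 0 < a) (t : Fin n) :
    (dataLaw d n).real {ω | a ≤ farCount lab k ω.2 (ω.2 t) (upperDist β d + 2 * c)}
      ≤ (members lab k).card * Real.exp (-(β + c ^ 2)) / a := by
  refine le_trans (measureReal_mono ?_) (real_le_card_filter_le (dataLaw d n) (members lab k)
    (fun s => {ω | upperDist β d + 2 * c < dist (ω.2 t) (ω.2 s)})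
    (fun s => measurableSet_lt measurable_const
      (((measurable_pi_apply t).comp measurable_snd).dist
        ((measurable_pi_apply s).comp measurable_snd)))
    (fun s _ => (dataLaw_real_dist_data_far_le hd hβ hc t s).trans
      (exp_neg_sqrt_add_sq_le_exp hβ hc)) ha)
  intro ω hω
  simp only [farCount, Set.mem_ofPred_eq] at hω ⊢
  convert hω

lemma dataLaw_real_nearCount_le (hd : 0 < d) {η γ a : ℝ} (hη : 0 ≤ η) (hγ : 0 ≤ γ)
    (hL : γ < lowerDist η d) (ha : 0 < a) :
    (dataLaw d n).real {ω | a ≤ ((members lab k).filter fun s =>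
        dist ω.1 (ω.2 s) < lowerDist η d - γ).card}
      ≤ (members lab k).card * Real.exp (-(η + γ ^ 2 / 2)) / a := by
  refine le_trans (measureReal_mono ?_) (real_le_card_filter_le (dataLaw d n) (members lab k)
    (fun s => {ω | dist ω.1 (ω.2 s) < lowerDist η d - γ})
    (fun s => measurableSet_lt
      (measurable_fst.dist ((measurable_pi_apply s).comp measurable_snd)) measurable_const)
    (fun s _ => (dataLaw_real_dist_point s measurableSet_Iio).trans_le
      (stdGaussian_prod_real_lt_lowerDist hd hη hγ hL)) ha)
  intro ω hω
  simp only [Set.mem_ofPred_eq] at hω ⊢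
  convert hω

/-- If few points of its Gaussian are close to `p`, then its density radius is not small. -/
lemma le_densityRadius_of_nearCount_lt {m : ℕ} (ω : Sample d n m) {f ρ : ℝ}
    (h : (((members lab k).filter fun s => dist ω.1 (ω.2.1 s) < ρ).card : ℝ) < f * n) :
    ENNReal.ofReal ρ ≤ densityRadius (stream lab ω) f (point k ω) := by
  by_contra hcon
  obtain ⟨r, hr, hrρ⟩ := sInf_lt_iff.1 (not_le.1 hcon)
  have hr' : f * n ≤ ballCount (stream lab ω) (point k ω) r := hr
  refine absurd (hr'.trans (Nat.cast_le.2 (Finset.card_le_card ?_))) (not_le.2 h)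
  intro t ht
  simp only [Finset.mem_filter, Finset.mem_univ, true_and, members] at ht ⊢
  have h1 : edist (point k ω) (stream lab ω t) < ENNReal.ofReal ρ := ht.trans_lt hrρ
  change (if k = lab t then edist ω.1 (ω.2.1 t) else ⊤) < _ at h1
  split_ifs at h1 with hk
  · exact ⟨hk.symm, by rwa [edist_lt_ofReal] at h1⟩
  · simp at h1

end Counts

/-! ### Dense points are covered. -/

section Covering

variable {K d n : ℕ} (lab : Fin n → Fin K) (k : Fin K)

lemma lowerDist_le_upperDist {η : ℝ} (hη : 0 ≤ η) (d : ℕ) : lowerDist η d ≤ upperDist η d := by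
  unfold lowerDist upperDist
  gcongr
  have := Real.sqrt_nonneg (d * η)
  linarith

lemma mem_coveredEvent {c β η f ε δ : ℝ} (hc : 0 < c) (hη : 0 ≤ η) (hβη : β ≤ η)
    (hL : 2 * c < lowerDist η d) {J : ℕ} (hJ : (J : ℝ) < ε * (f * n) + 1)
    {ω : Sample d n (memorySize f ε δ)}
    (hnear : (((members lab k).filter fun s =>
      dist ω.1 (ω.2.1 s) < lowerDist η d - c).card : ℝ) < f * n)
    {t : Fin n} (ht : t ∈ members lab k)
    (htJ : (members lab k).card + 1 ≤ ((members lab k).filter fun s => t ≤ s).card + J)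
    (hdist : dist ω.1 (ω.2.1 t) ≤ upperDist η d + c)
    (hfar : (farCount lab k ω.2.1 (ω.2.1 t) (upperDist β d + 2 * c) : ℝ)
      ≤ (members lab k).card - f * n)
    {i : Fin (memorySize f ε δ)} (hi : ω.2.2 i ∈ lastHop t) :
    ω ∈ coveredEvent c β f ε δ lab k (delta₁ c η d) (delta₂ c η d) := by
  have hk : lab t = k := by simpa [members] using ht
  have hρ : 0 ≤ upperDist β d + 2 * c := by
    have := upperDist_nonneg β d
    positivity
  have hrad := le_densityRadius_of_nearCount_lt lab k ω hnear
  have hU := upperDist_mono d hβη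
  have hLU := lowerDist_le_upperDist hη d
  have hpos : 0 < lowerDist η d - 2 * c := by linarith
  -- Cross-multiplied, this reduces to `L ≤ U + 2 * c`.
  have h1 : upperDist η d + c ≤ (1 + delta₁ c η d) * (lowerDist η d - c) := by
    rw [delta₁, add_sub_cancel, div_mul_eq_mul_div, le_div_iff₀ hpos]
    nlinarith
  have h2 : upperDist β d + 2 * c ≤ (1 + delta₂ c η d) * (lowerDist η d - c) := by
    rw [delta₂, add_sub_cancel, div_mul_eq_mul_div, le_div_iff₀ hpos]
    nlinarith [upperDist_nonneg η d]
  have h0 : 0 ≤ lowerDist η d - c := by linarith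
  refine ⟨stream lab ω t, ENNReal.ofReal (upperDist β d + 2 * c),
    mem_outputs_of_farCount_le lab k ω hρ hJ ht htJ hfar hi, ?_, ?_, ?_⟩
  · calc edist (point k ω) (stream lab ω t) ≤ ENNReal.ofReal (upperDist η d + c) :=
          (edist_mk_le_iff (by linarith [upperDist_nonneg η d])).2 ⟨hk.symm, hdist⟩
      _ ≤ ENNReal.ofReal (1 + delta₁ c η d) * ENNReal.ofReal (lowerDist η d - c) := by
          rw [← ENNReal.ofReal_mul' h0]
          exact ENNReal.ofReal_le_ofReal h1
      _ ≤ _ := by gcongr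
  · rw [densityRadius_le_iff ENNReal.ofReal_ne_top, IsDense]
    have h3 := ballCount_add_farCount lab k ω (ω.2.1 t) hρ
    have h4 : (⟨k, ω.2.1 t⟩ : FarPoint K d) = stream lab ω t := by rw [stream, hk]
    rw [h4] at h3
    have h5 : (ballCount (stream (K := K) lab ω) (stream lab ω t)
        (ENNReal.ofReal (upperDist β d + 2 * c)) : ℝ)
        + farCount lab k ω.2.1 (ω.2.1 t) (upperDist β d + 2 * c) = (members lab k).card := by
      exact_mod_cast h3
    linarith
  · calc ENNReal.ofReal (upperDist β d + 2 * c)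
        ≤ ENNReal.ofReal (1 + delta₂ c η d) * ENNReal.ofReal (lowerDist η d - c) := by
          rw [← ENNReal.ofReal_mul' h0]
          exact ENNReal.ofReal_le_ofReal h2
      _ ≤ _ := by gcongr

/-- On any event about the point and the data, the point is covered up to a small probability. -/
lemma law_real_inter_compl_coveredEvent_le {c β η f ε δ : ℝ} (hc : 0 < c) (hβ : 0 < β)
    (hκ : 2 * kappa c < 1) (hd : 0 < d) (hn : 0 < n) (hf : 0 < f)
    (hε : 0 < ε) (hε1 : ε < 1) (hδ : 0 < δ) (hβη : β ≤ η)
    (hell : 2 * ell c η * freq lab k ≤ f) (hL : 2 * c < lowerDist η d)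
    (hfreq : fHat c f ≤ freq lab k) {A : Set (DataSpace d n)} (hA : MeasurableSet A) :
    (law d n (memorySize f ε δ)).real ({ω | (ω.1, ω.2.1) ∈ A} ∩
        (coveredEvent c β f ε δ lab k (delta₁ c η d) (delta₂ c η d))ᶜ)
      ≤ f * δ * (dataLaw d n).real A + 3 / 5 * kappa c := by
  have hη : 0 < η := hβ.trans_le hβη
  have hk := kappa_pos hc
  have hn' : (0 : ℝ) < n := by exact_mod_cast hn
  set N := (members lab k).card with hN
  have hNf : freq lab k * n = N := freq_mul lab k hn
  have hfn : 0 < f * n := by positivity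
  have hup : f * n ≤ (1 - 2 * kappa c) * N := by
    rw [fHat, div_le_iff₀ (by linarith)] at hfreq
    calc f * n ≤ freq lab k * (1 - 2 * kappa c) * n := by gcongr
      _ = (1 - 2 * kappa c) * N := by rw [← hNf]; ring
  have hlow : 2 * ell c η * N ≤ f * n := by
    rw [← hNf, ← mul_assoc]
    gcongr
  have hN0 : (0 : ℝ) < N := by
    by_contra hcon
    nlinarith
  have hle : Real.exp (-η) ≤ ell c η := by
    rw [ell, le_div_iff₀ (by linarith)]
    nlinarith [Real.exp_pos (-η)]
  -- Forced by `2 l N ≤ f n ≤ N`.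
  have hexp : Real.exp (-η) ≤ 1 / 2 := by
    have h1 : 2 * ell c η * N ≤ 1 * N := by nlinarith
    have h2 := le_of_mul_le_mul_right h1 hN0
    linarith
  have hgap : 2 * kappa c * N ≤ N - f * n := by linarith
  have hgap0 : 0 < N - f * n := by
    have : 0 < 2 * kappa c * N := by positivity
    linarith
  set J := ⌈ε * (f * n)⌉₊ with hJ
  have hJ1 : (J : ℝ) < ε * (f * n) + 1 := Nat.ceil_lt_add_one (by positivity)
  have hJ2 : ε * (f * n) ≤ J := Nat.le_ceil _
  have hJ0 : 0 < J := Nat.ceil_pos.2 (by positivity)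
  have hJN : J ≤ N := Nat.ceil_le.2 (by nlinarith)
  obtain ⟨F, hFS, hFJ, hF⟩ := exists_initial_subset (S := members lab k) hJN
  have hFne : F.Nonempty := Finset.card_pos.1 (by omega)
  have hJn : (J : ℝ) ≤ n := by
    rw [← hFJ]
    exact_mod_cast (Finset.card_le_univ F).trans_eq (Fintype.card_fin n)
  set good : Fin n → Set (DataSpace d n) := fun t =>
    {ω | dist ω.1 (ω.2 t) ≤ upperDist η d + c} ∩
      {ω | (farCount lab k ω.2 (ω.2 t) (upperDist β d + 2 * c) : ℝ) ≤ N - f * n} with hgood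
  have hgoodm (t : Fin n) : MeasurableSet (good t) := by
    have ht : Measurable fun ω : DataSpace d n => ω.2 t :=
      (measurable_pi_apply t).comp measurable_snd
    exact (measurableSet_le (measurable_fst.dist ht) measurable_const).inter
      (measurableSet_le (measurable_farCount lab k ht _) measurable_const)
  have hb (t : Fin n) : (dataLaw d n).real (good t)ᶜ
      ≤ 9 / 32 * kappa c + 9 / 128 * kappa c := by
    rw [hgood]
    simp only
    rw [Set.compl_inter]
    refine (measureReal_union_le _ _).trans (add_le_add ?_ ?_)
    · refine le_trans (measureReal_mono ?_) ((dataLaw_real_dist_point_far_le hd hη.le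
        (by positivity : 0 ≤ c / 2) t).trans (exp_neg_sqrt_add_sq_le hc hexp))
      intro ω hω
      simp only [Set.mem_compl_iff, Set.mem_ofPred_eq, not_le] at hω ⊢
      linarith
    · refine le_trans (measureReal_mono ?_)
        ((dataLaw_real_farCount_data_le lab k hd hβ.le hc.le hgap0 t).trans ?_)
      · intro ω hω
        simp only [Set.mem_compl_iff, Set.mem_ofPred_eq, not_le] at hω ⊢
        exact hω.le
      · have h1 : Real.exp (-(β + c ^ 2)) ≤ 9 / 64 * kappa c ^ 2 := by
          refine le_trans ?_ (exp_neg_sq_le hc)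
          rw [Real.exp_le_exp]
          linarith
        rw [div_le_iff₀ hgap0]
        calc (N : ℝ) * Real.exp (-(β + c ^ 2)) ≤ N * (9 / 64 * kappa c ^ 2) := by gcongr
          _ = 9 / 128 * kappa c * (2 * kappa c * N) := by ring
          _ ≤ _ := by gcongr
  have ha : (1 - (F.card : ℝ) / n) ^ memorySize f ε δ ≤ f * δ := by
    refine pow_memorySize_le hf hε hδ ?_ ?_
    · rw [hFJ, le_div_iff₀ hn']
      linarith
    · rw [hFJ, div_le_one hn']
      exact hJn
  have hmiss := law_real_miss_le F hFne hA hgoodm ha (fun t _ => hb t)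
  set B : Set (DataSpace d n) := {ω | f * n ≤ ((members lab k).filter fun s =>
    dist ω.1 (ω.2 s) < lowerDist η d - c).card} with hB
  have hBm : MeasurableSet B := measurableSet_le measurable_const
    (measurable_card_filter _ _ fun s => measurableSet_lt
      (measurable_fst.dist ((measurable_pi_apply s).comp measurable_snd)) measurable_const)
  have hBle : (dataLaw d n).real B ≤ 3 / 16 * kappa c := by
    refine ((dataLaw_real_nearCount_le lab k hd hη.le hc.le (by linarith) hfn).trans ?_).trans
      (half_exp_neg_half_sq_le hc)
    rw [div_le_iff₀ hfn, neg_add, Real.exp_add]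
    have h1 : 2 * Real.exp (-η) * N ≤ f * n := le_trans (by gcongr) hlow
    have h2 := mul_le_mul_of_nonneg_left h1 (Real.exp_pos (-(c ^ 2 / 2))).le
    linarith
  have hsub : {ω : Sample d n (memorySize f ε δ) | (ω.1, ω.2.1) ∈ A} ∩
        (coveredEvent c β f ε δ lab k (delta₁ c η d) (delta₂ c η d))ᶜ
      ⊆ {ω | (ω.1, ω.2.1) ∈ B} ∪ {ω | (ω.1, ω.2.1) ∈ A ∧
        ∀ i, ∀ t ∈ F, (ω.1, ω.2.1) ∈ good t → ω.2.2 i ∉ lastHop t} := by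
    rintro ω ⟨hωA, hω⟩
    by_cases hωB : (ω.1, ω.2.1) ∈ B
    · exact Or.inl hωB
    · refine Or.inr ⟨hωA, fun i t ht hgt hi => hω ?_⟩
      exact mem_coveredEvent lab k hc hη.le hβη hL hJ1 (not_le.1 hωB) (hFS ht) (hF t ht)
        hgt.1 hgt.2 hi
  refine (measureReal_mono hsub).trans ((measureReal_union_le _ _).trans ?_)
  rw [law_real_data d n _ hBm]
  -- The budget is `3/16 + 9/32 + 9/128 = 69/128 ≤ 3/5`.
  linarith

lemma mem_denseEvent_iff {c β f ε δ : ℝ} (hc : 0 < c) (hn : 0 < n)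
    (ω : Sample d n (memorySize f ε δ)) :
    ω ∈ denseEvent c β f ε δ lab k ↔
      (farCount lab k ω.2.1 ω.1 (upperDist β d + 2 * c) : ℝ)
        ≤ (freq lab k - fHat c f) * n := by
  have hρ : 0 ≤ upperDist β d + 2 * c := by
    have := upperDist_nonneg β d
    positivity
  have h3 : (ballCount (stream (K := K) lab ω) (point k ω)
        (ENNReal.ofReal (upperDist β d + 2 * c)) : ℝ)
        + farCount lab k ω.2.1 ω.1 (upperDist β d + 2 * c) = (members lab k).card := by
    exact_mod_cast ballCount_add_farCount lab k ω ω.1 hρ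
  have h4 := freq_mul lab k hn
  change densityRadius _ _ _ ≤ hacRadius c β d ↔ _
  rw [hacRadius, densityRadius_le_iff ENNReal.ofReal_ne_top, IsDense, sub_mul]
  constructor <;> intro h <;> linarith

theorem law_real_covered_bounds {c β η f ε δ : ℝ} (hc : 0 < c) (hβ : 0 < β)
    (hκ : 2 * kappa c < 1) (hd : 0 < d) (hf : 0 < f)
    (hε : 0 < ε) (hε1 : ε < 1) (hδ : 0 < δ) (hβη : β ≤ η)
    (hell : 2 * ell c η * freq lab k ≤ f) (hL : 2 * c < lowerDist η d) :
    1 - kappa c - δ * f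
        - Real.exp (-(f * n) / 3) * (Real.exp (kappa c) + Real.exp (ell c β))
      ≤ (law d n (memorySize f ε δ)).real
          ((denseEvent c β f ε δ lab k)ᶜ ∪
            coveredEvent c β f ε δ lab k (delta₁ c η d) (delta₂ c η d)) ∧
    (fHat c f ≤ (1 - 2 * ell c β) * freq lab k →
      1 - kappa c - δ * f
          - Real.exp (-(f * n) / 3) * (Real.exp (kappa c) + Real.exp (ell c β))
        ≤ ((law d n (memorySize f ε δ))[|denseEvent c β f ε δ lab k]).real
            (coveredEvent c β f ε δ lab k (delta₁ c η d) (delta₂ c η d))) := by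
  have hk := kappa_pos hc
  have hfδ : 0 < f * δ := by positivity
  have hlβ : 0 < ell c β := div_pos (Real.exp_pos _) (by linarith)
  rcases Nat.eq_zero_or_pos n with rfl | hn
  -- For `n = 0` the claimed lower bound is not positive, since `exp κ ≥ 1`.
  · have h : 1 - kappa c - δ * f
        - Real.exp (-(f * (0 : ℕ)) / 3) * (Real.exp (kappa c) + Real.exp (ell c β)) ≤ 0 := by
      have h1 := Real.one_le_exp hk.le
      have h2 := Real.exp_pos (ell c β)
      simp only [Nat.cast_zero, mul_zero, neg_zero, zero_div, Real.exp_zero, one_mul]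
      linarith
    exact ⟨h.trans measureReal_nonneg, fun _ => h.trans measureReal_nonneg⟩
  have hX : 0 ≤ Real.exp (-(f * n) / 3) * (Real.exp (kappa c) + Real.exp (ell c β)) := by
    positivity
  have hn' : (0 : ℝ) < n := by exact_mod_cast hn
  set cov := coveredEvent c β f ε δ lab k (delta₁ c η d) (delta₂ c η d) with hcov
  refine ⟨?_, fun hfh => ?_⟩
  · rcases lt_or_ge (freq lab k) (fHat c f) with hlt | hge
    -- A cluster with fewer than `f̂ n` members cannot make `p` dense.
    · have : denseEvent c β f ε δ lab k (d := d) = ∅ := by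
        ext ω
        rw [mem_denseEvent_iff lab k hc hn]
        simp only [Set.mem_empty_iff_false, iff_false, not_le]
        exact (mul_neg_of_neg_of_pos (by linarith) hn').trans_le (Nat.cast_nonneg _)
      rw [this]
      simp only [Set.compl_empty, Set.univ_union, probReal_univ]
      linarith
    · have h := law_real_inter_compl_coveredEvent_le lab k hc hβ hκ hd hn hf hε hε1 hδ hβη
        hell hL hge (A := Set.univ) MeasurableSet.univ
      simp only [Set.mem_univ, Set.ofPred_true, Set.univ_inter, probReal_univ] at h
      have h2 : (1 : ℝ) ≤ (law d n (memorySize f ε δ)).real cov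
          + (law d n (memorySize f ε δ)).real covᶜ := by
        have := measureReal_union_le (μ := law d n (memorySize f ε δ)) cov covᶜ
        rwa [Set.union_compl_self, probReal_univ] at this
      have h3 : (law d n (memorySize f ε δ)).real cov ≤ _ :=
        measureReal_mono (Set.subset_union_right (s := (denseEvent c β f ε δ lab k)ᶜ))
      linarith
  · have hfpos : 0 < fHat c f := div_pos hf (by linarith)
    have hfreq0 : 0 < freq lab k := by
      have : 0 ≤ freq lab k := by unfold freq; positivity
      refine lt_of_le_of_ne this fun h0 => ?_
      rw [← h0, mul_zero] at hfh
      linarith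
    have hge : fHat c f ≤ freq lab k := by nlinarith
    set A : Set (DataSpace d n) := {ω | (farCount lab k ω.2 ω.1 (upperDist β d + 2 * c) : ℝ)
        ≤ (freq lab k - fHat c f) * n} with hA
    have hAm : MeasurableSet A :=
      measurableSet_le (measurable_farCount lab k measurable_fst _) measurable_const
    have hdense : denseEvent c β f ε δ lab k = {ω | (ω.1, ω.2.1) ∈ A} := by
      ext ω
      exact mem_denseEvent_iff lab k hc hn ω
    have hdm : MeasurableSet (denseEvent c β f ε δ lab k (d := d)) := by
      have hm : Measurable fun ω : Sample d n (memorySize f ε δ) => (ω.1, ω.2.1) := by fun_prop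
      rw [hdense]
      exact hm hAm
    have hN := freq_mul lab k hn
    have hN0 : (0 : ℝ) < (members lab k).card := by rw [← hN]; positivity
    have hgap : 2 * ell c β * (members lab k).card ≤ (freq lab k - fHat c f) * n := by
      rw [← hN, ← mul_assoc]
      gcongr
      linarith
    have hgap0 : 0 < (freq lab k - fHat c f) * n := lt_of_lt_of_le (by positivity) hgap
    have hAc : (dataLaw d n).real Aᶜ ≤ 1 / 5 := by
      refine le_trans (measureReal_mono ?_)
        ((dataLaw_real_farCount_point_le lab k hd hβ.le hc.le hgap0).trans ?_)
      · intro ω hω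
        simp only [hA, Set.mem_compl_iff, Set.mem_ofPred_eq, not_le] at hω ⊢
        exact hω.le
      · have h1 := exp_neg_sq_le hc
        have h2 : Real.exp (-β) ≤ ell c β := by
          rw [ell, le_div_iff₀ (by linarith)]
          nlinarith [Real.exp_pos (-β)]
        have h3 : Real.exp (-c ^ 2) ≤ 2 / 5 := by nlinarith
        rw [div_le_iff₀ hgap0, neg_add, Real.exp_add]
        calc (members lab k).card * (Real.exp (-β) * Real.exp (-c ^ 2))
            ≤ (members lab k).card * (ell c β * (2 / 5)) := by gcongr
          _ = 1 / 5 * (2 * ell c β * (members lab k).card) := by ring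
          _ ≤ _ := by gcongr
    rw [probReal_compl_eq_one_sub hAm] at hAc
    set P := (dataLaw d n).real A with hP
    have hPd : (law d n (memorySize f ε δ)).real (denseEvent c β f ε δ lab k) = P := by
      rw [hdense, law_real_data d n _ hAm]
    have h := law_real_inter_compl_coveredEvent_le lab k hc hβ hκ hd hn hf hε hε1 hδ hβη
        hell hL hge hAm
    rw [← hdense] at h
    have h2 := measureReal_union_le (μ := law d n (memorySize f ε δ))
      (denseEvent c β f ε δ lab k ∩ cov) (denseEvent c β f ε δ lab k ∩ covᶜ)
    rw [Set.inter_union_compl, hPd] at h2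
    rw [measureReal_def, cond_apply hdm, ENNReal.toReal_mul, ENNReal.toReal_inv, ← measureReal_def,
      ← measureReal_def, hPd, ← div_eq_inv_mul, le_div_iff₀ (by linarith)]
    -- Since `P ≥ 4 / 5`, the geometric error stays below `κ` after division by `P`.
    have h4 : 3 / 5 * kappa c ≤ kappa c * P := by nlinarith
    have h5 := mul_nonneg hX (by linarith : 0 ≤ P)
    linarith

end Covering

/-! ### Sparse points have no output in their cluster. -/

section FalsePositives

variable {K d n : ℕ} (lab : Fin n → Fin K) (k : Fin K)

lemma exists_mem_lastHop_of_cellRun_eq_some {X : Type*} [PseudoEMetricSpace X] (r : ℝ≥0∞) {n : ℕ}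
    (x : Fin n → X) {h : Fin n → Bool} {a : X × ℕ} (ha : cellRun r n x h = some a) :
    ∃ t, h ∈ lastHop t := by
  induction n generalizing a with
  | zero => simp [cellRun] at ha
  | succ n ih =>
    by_cases hl : h (Fin.last n) = true
    · exact ⟨Fin.last n, hl, fun s hs => absurd hs (Fin.le_last s).not_gt⟩
    · cases hrun : cellRun r n (fun t => x t.castSucc) (fun t => h t.castSucc) with
      | none => simp [cellRun, cellStep, hl, hrun] at ha
      | some b =>
        obtain ⟨t, ht1, ht2⟩ := ih _ hrun
        refine ⟨t.castSucc, ht1, fun s hs => ?_⟩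
        induction s using Fin.lastCases with
        | last => simpa using hl
        | cast s => exact ht2 s (Fin.castSucc_lt_castSucc_iff.1 hs)

/-- Finite distance means the same cluster: this holds for `p` and `o`, and for `o` and every point
that its counter counts. -/
lemma le_card_members_of_mem_outputs {m : ℕ} {ω : Sample d n m} {r : ℝ≥0∞} (hr : r ≠ ⊤)
    {f ε : ℝ} {o : FarPoint K d} {ρ : ℝ≥0∞}
    (ho : (o, ρ) ∈ outputs r f ε (stream lab ω) ω.2.2) (hfin : edist (point k ω) o < ⊤) :
    (1 - ε) * f * n ≤ (members lab k).card ∧ 0 < (members lab k).card := by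
  classical
  obtain ⟨-, i, cnt, hrun, hcnt⟩ := ho
  obtain ⟨t, ht⟩ := exists_mem_lastHop_of_cellRun_eq_some _ _ hrun
  rw [cellRun_of_mem_lastHop _ _ ht, Option.some.injEq, Prod.mk.injEq] at hrun
  obtain ⟨h1, h2⟩ := hrun
  simp only at h1
  subst h1
  have hcl {y z : FarPoint K d} (h : edist y z < ⊤) : y.cluster = z.cluster := by
    change (if y.cluster = z.cluster then edist y.pos z.pos else ⊤) < ⊤ at h
    split_ifs at h with hh
    · exact hh
    · simp at h
  have hkt : k = lab t := hcl hfin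
  have htm : t ∈ members lab k := by simp [members, hkt]
  refine ⟨hcnt.trans ?_, Finset.card_pos.2 ⟨t, htm⟩⟩
  rw [← h2]
  norm_cast
  refine Finset.card_le_card fun s hs => ?_
  simp only [Finset.mem_filter, Finset.mem_univ, true_and, members] at hs ⊢
  have : lab t = lab s := hcl (hs.2.trans_lt hr.lt_top)
  rw [← this, hkt]

theorem law_real_falsePositiveEvent_le {c β f ε δ : ℝ} (hc : 0 < c) (hβ : 0 < β)
    (hκ : 2 * kappa c < 1) (hd : 0 < d) (hf : 0 < f) (hε1 : ε < 1) :
    (law d n (memorySize f ε δ)).real (falsePositiveEvent c β f ε δ lab k)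
      ≤ kappa c + Real.exp (-(f * n) / 3) := by
  have hk := kappa_pos hc
  have hl : 0 < ell c β := div_pos (Real.exp_pos _) (by linarith)
  have hρ : 0 ≤ upperDist β d + 2 * c := by
    have := upperDist_nonneg β d
    positivity
  have hX := Real.exp_pos (-(f * n) / 3)
  set A : Set (DataSpace d n) := {ω | 2 * ell c β * (members lab k).card
    ≤ farCount lab k ω.2 ω.1 (upperDist β d + 2 * c)} with hA
  have hAm : MeasurableSet A :=
    measurableSet_le measurable_const (measurable_farCount lab k measurable_fst _)
  have hsub : ∀ ω ∈ falsePositiveEvent c β f ε δ lab k (d := d),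
      0 < (members lab k).card ∧ (ω.1, ω.2.1) ∈ A := by
    rintro ω ⟨hrad, o, ρ, ho, hfin⟩
    obtain ⟨h1, h2⟩ := le_card_members_of_mem_outputs lab k ENNReal.ofReal_ne_top ho hfin
    refine ⟨h2, ?_⟩
    rw [← not_le, hacRadius, densityRadius_le_iff ENNReal.ofReal_ne_top, IsDense, not_le] at hrad
    have h3 : (ballCount (stream (K := K) lab ω) (point k ω)
        (ENNReal.ofReal (upperDist β d + 2 * c)) : ℝ)
        + farCount lab k ω.2.1 ω.1 (upperDist β d + 2 * c) = (members lab k).card := by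
      exact_mod_cast ballCount_add_farCount lab k ω ω.1 hρ
    have h4 : (0 : ℝ) ≤ ballCount (stream (K := K) lab ω) (point k ω)
        (ENNReal.ofReal (upperDist β d + 2 * c)) := Nat.cast_nonneg _
    have h5 : 0 ≤ (1 - ε) * f * n :=
      mul_nonneg (mul_nonneg (by linarith) hf.le) (Nat.cast_nonneg n)
    -- Otherwise the density threshold is at most `0` and `p` is trivially dense.
    have h6 : 0 < 1 - 2 * ell c β := by
      by_contra hcon
      nlinarith
    have h7 := mul_le_mul_of_nonneg_left h1 h6.le
    simp only [hA, Set.mem_ofPred_eq]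
    linarith
  -- Markov's inequality needs the positive threshold `2 l N`.
  rcases Nat.eq_zero_or_pos (members lab k).card with h0 | hN
  · have : falsePositiveEvent c β f ε δ lab k (d := d) = ∅ :=
      Set.eq_empty_of_forall_notMem fun ω hω => (hsub ω hω).1.ne' h0
    rw [this, measureReal_empty]
    positivity
  · have hN' : (0 : ℝ) < (members lab k).card := by exact_mod_cast hN
    have hsub' : falsePositiveEvent c β f ε δ lab k (d := d) ⊆ {ω | (ω.1, ω.2.1) ∈ A} :=
      fun ω hω => (hsub ω hω).2
    refine (measureReal_mono hsub').trans ?_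
    rw [law_real_data d n _ hAm]
    have ha : 0 < 2 * ell c β * (members lab k).card := by positivity
    refine (dataLaw_real_farCount_point_le lab k hd hβ.le hc.le ha).trans ?_
    have h1 := exp_neg_sq_le hc
    have h2 : Real.exp (-β) ≤ ell c β := by
      rw [ell, le_div_iff₀ (by linarith)]
      nlinarith [Real.exp_pos (-β)]
    have h3 : Real.exp (-c ^ 2) ≤ 2 * kappa c := by nlinarith
    refine le_trans ?_ (le_add_of_nonneg_right hX.le)
    rw [div_le_iff₀ ha, neg_add, Real.exp_add]
    calc (members lab k).card * (Real.exp (-β) * Real.exp (-c ^ 2))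
        ≤ (members lab k).card * (ell c β * (2 * kappa c)) := by gcongr
      _ = _ := by ring

end FalsePositives

/-! ### Expansion of `Δ₁` and `Δ₂` in the dimension. -/

section Asymptotics

lemma abs_sqrt_sub_one_add_le {x : ℝ} (h0 : 0 ≤ x) :
    |Real.sqrt (1 + 2 * x + 2 * x ^ 2) - (1 + x)| ≤ x ^ 2 := by
  rw [abs_le]
  constructor
  · have : 1 + x ≤ Real.sqrt (1 + 2 * x + 2 * x ^ 2) := Real.le_sqrt_of_sq_le (by nlinarith)
    nlinarith
  · have : Real.sqrt (1 + 2 * x + 2 * x ^ 2) ≤ 1 + x + x ^ 2 :=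
      Real.sqrt_le_iff.2 ⟨by positivity, by nlinarith [pow_nonneg h0 3, pow_nonneg h0 4]⟩
    linarith

lemma abs_sqrt_sub_one_sub_le {x : ℝ} (h0 : 0 ≤ x) (h1 : x ≤ 1 / 8) :
    |Real.sqrt (1 - 2 * x) - (1 - x)| ≤ x ^ 2 := by
  rw [abs_le]
  constructor
  · have : 1 - x - x ^ 2 ≤ Real.sqrt (1 - 2 * x) := by
      refine Real.le_sqrt_of_sq_le ?_
      have h2 : x ^ 3 ≤ 1 / 8 * x ^ 2 := by nlinarith [sq_nonneg x]
      have h3 : x ^ 4 ≤ 1 / 8 * x ^ 2 := by nlinarith [sq_nonneg x]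
      nlinarith [sq_nonneg x]
    linarith
  · have : Real.sqrt (1 - 2 * x) ≤ 1 - x := Real.sqrt_le_iff.2 ⟨by linarith, by nlinarith⟩
    nlinarith

/-- The expansion of the ratios of distances, where `x = √(η / d)` and `w = c √(2 / d)`. -/
lemma abs_ratio_sub_le {x w : ℝ} (hx : 0 ≤ x) (hx1 : x ≤ 1 / 8) (hw : 0 ≤ w) (hw1 : w ≤ 1 / 8) :
    |Real.sqrt (1 + 2 * x + 2 * x ^ 2) / (Real.sqrt (1 - 2 * x) - w) - 1 - (w + 2 * x)|
        ≤ 10 * (x + w) ^ 2 ∧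
    |(Real.sqrt (1 + 2 * x + 2 * x ^ 2) + w) / (Real.sqrt (1 - 2 * x) - w) - 1 - (2 * w + 2 * x)|
        ≤ 10 * (x + w) ^ 2 := by
  have hA := abs_le.1 (abs_sqrt_sub_one_add_le hx)
  have hB := abs_le.1 (abs_sqrt_sub_one_sub_le hx hx1)
  set u := Real.sqrt (1 + 2 * x + 2 * x ^ 2)
  set v := Real.sqrt (1 - 2 * x)
  have hv : 1 / 2 ≤ v - w := by nlinarith
  have hv0 : 0 < v - w := by linarith
  have hxw : 0 ≤ x * w := mul_nonneg hx hw
  obtain ⟨A, hAu⟩ : ∃ A, u = 1 + x + A := ⟨u - (1 + x), by ring⟩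
  obtain ⟨B, hBv⟩ : ∃ B, v = 1 - x + B := ⟨v - (1 - x), by ring⟩
  have hA1 : |A| ≤ x ^ 2 := abs_le.2 (by constructor <;> linarith)
  have hB1 : |B| ≤ x ^ 2 := abs_le.2 (by constructor <;> linarith)
  have hx2 : x ^ 2 ≤ (x + w) ^ 2 := by nlinarith
  -- Both remainders have this form, with `y` the main term and `z` its product with `x + w`. The
  -- numerator is at most `5 (x + w)²`, and `v - w ≥ 1 / 2` doubles it.
  have key (y z : ℝ) (hy : 0 ≤ y) (hy1 : y ≤ 1) (hz : |z| ≤ 2 * (x + w) ^ 2) :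
      |A - B + z - y * B| / (v - w) ≤ 10 * (x + w) ^ 2 := by
    rw [div_le_iff₀ hv0]
    have h1 : |A - B + z - y * B| ≤ |A| + |B| + |z| + y * |B| := by
      have := abs_sub (A - B + z) (y * B)
      have := abs_add_le (A - B) z
      have := abs_sub A B
      rw [abs_mul, abs_of_nonneg hy] at *
      linarith
    have h2 : y * |B| ≤ 1 * |B| := mul_le_mul_of_nonneg_right hy1 (abs_nonneg _)
    nlinarith [sq_nonneg (x + w)]
  constructor
  · have h : u / (v - w) - 1 - (w + 2 * x)
        = (A - B + (w + 2 * x) * (x + w) - (w + 2 * x) * B) / (v - w) := by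
      rw [eq_div_iff hv0.ne', sub_mul, sub_mul, div_mul_cancel₀ _ hv0.ne', hAu, hBv]
      ring
    rw [h, abs_div, abs_of_pos hv0]
    refine key _ _ (by positivity) (by linarith) ?_
    rw [abs_of_nonneg (by positivity)]
    nlinarith
  · have h : (u + w) / (v - w) - 1 - (2 * w + 2 * x)
        = (A - B + 2 * (x + w) ^ 2 - (2 * w + 2 * x) * B) / (v - w) := by
      rw [eq_div_iff hv0.ne', sub_mul, sub_mul, div_mul_cancel₀ _ hv0.ne', hAu, hBv]
      ring
    rw [h, abs_div, abs_of_pos hv0]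
    refine key _ _ (by positivity) (by linarith) ?_
    rw [abs_of_nonneg (by positivity)]

lemma upperDist_eq {d : ℕ} (hd : 0 < d) {η : ℝ} (hη : 0 ≤ η) :
    upperDist η d = Real.sqrt 2 * Real.sqrt d *
      Real.sqrt (1 + 2 * Real.sqrt (η / d) + 2 * Real.sqrt (η / d) ^ 2) := by
  have hd' : (0 : ℝ) < d := by exact_mod_cast hd
  rw [upperDist, mul_assoc, ← Real.sqrt_mul hd'.le]
  congr 2
  have h : Real.sqrt (d * η) = d * Real.sqrt (η / d) := by
    rw [show (d : ℝ) * η = d ^ 2 * (η / d) by field_simp, Real.sqrt_mul (by positivity),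
      Real.sqrt_sq hd'.le]
  rw [h, Real.sq_sqrt (by positivity)]
  field_simp

lemma lowerDist_eq {d : ℕ} (hd : 0 < d) {η : ℝ} :
    lowerDist η d = Real.sqrt 2 * Real.sqrt d * Real.sqrt (1 - 2 * Real.sqrt (η / d)) := by
  have hd' : (0 : ℝ) < d := by exact_mod_cast hd
  rw [lowerDist, mul_assoc, ← Real.sqrt_mul hd'.le]
  congr 2
  have h : Real.sqrt (d * η) = d * Real.sqrt (η / d) := by
    rw [show (d : ℝ) * η = d ^ 2 * (η / d) by field_simp, Real.sqrt_mul (by positivity),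
      Real.sqrt_sq hd'.le]
  rw [h]
  ring

/-- With `upperDist_eq` and `lowerDist_eq`, this pulls `√2 √d` out of `U`, `L` and `2 c`, so that it
cancels in the ratios. -/
lemma two_mul_eq_sqrt {d : ℕ} (hd : 0 < d) (c : ℝ) :
    2 * c = Real.sqrt 2 * Real.sqrt d * (c * Real.sqrt (2 / d)) := by
  have hd' : (0 : ℝ) < d := by exact_mod_cast hd
  have h : Real.sqrt 2 * Real.sqrt d * Real.sqrt (2 / d) = 2 := by
    rw [← Real.sqrt_mul (by norm_num), ← Real.sqrt_mul (by positivity),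
      show (2 * d * (2 / d) : ℝ) = 2 ^ 2 by field_simp, Real.sqrt_sq (by norm_num)]
  linear_combination (-c) * h

lemma sqrt_div_natCast (a : ℝ) (ha : 0 ≤ a) (d : ℕ) :
    Real.sqrt (a / d) = Real.sqrt a * (d : ℝ) ^ (-(1 / 2) : ℝ) := by
  rw [Real.sqrt_div ha, Real.rpow_neg (Nat.cast_nonneg d), ← Real.sqrt_eq_rpow, div_eq_mul_inv]

lemma tendsto_sqrt_div_natCast (a : ℝ) :
    Tendsto (fun d : ℕ => Real.sqrt (a / d)) atTop (nhds 0) := by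
  have h := (tendsto_const_div_atTop_nhds_zero_nat a).sqrt
  rwa [Real.sqrt_zero] at h

theorem delta_expansions {c η : ℝ} (hc : 0 < c) (hη : 0 < η) :
    ((fun d : ℕ => delta₁ c η d - (c * Real.sqrt (2 / d) + 2 * Real.sqrt (η / d)))
      =O[atTop] fun d : ℕ => (1 : ℝ) / d) ∧
    ((fun d : ℕ => delta₂ c η d - (2 * c * Real.sqrt (2 / d) + 2 * Real.sqrt (η / d)))
      =O[atTop] fun d : ℕ => (1 : ℝ) / d) := by
  have hx := (tendsto_sqrt_div_natCast η).eventually (ge_mem_nhds (by norm_num : (0 : ℝ) < 1 / 8))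
  have hw' : Tendsto (fun d : ℕ => c * Real.sqrt (2 / d)) atTop (nhds 0) := by
    simpa using (tendsto_sqrt_div_natCast 2).const_mul c
  have hw := hw'.eventually (ge_mem_nhds (by norm_num : (0 : ℝ) < 1 / 8))
  have main : ∀ᶠ d : ℕ in atTop,
      |delta₁ c η d - (c * Real.sqrt (2 / d) + 2 * Real.sqrt (η / d))|
          ≤ 10 * (Real.sqrt η + c * Real.sqrt 2) ^ 2 * (1 / d) ∧
      |delta₂ c η d - (2 * c * Real.sqrt (2 / d) + 2 * Real.sqrt (η / d))|
          ≤ 10 * (Real.sqrt η + c * Real.sqrt 2) ^ 2 * (1 / d) := by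
    filter_upwards [hx, hw, eventually_gt_atTop 0] with d hxd hwd hd
    have hd' : (0 : ℝ) < d := by exact_mod_cast hd
    have h := abs_ratio_sub_le (Real.sqrt_nonneg (η / d)) hxd
      (by positivity : 0 ≤ c * Real.sqrt (2 / d)) hwd
    have hs : Real.sqrt 2 * Real.sqrt d ≠ 0 := by positivity
    have h1 : delta₁ c η d = Real.sqrt (1 + 2 * Real.sqrt (η / d) + 2 * Real.sqrt (η / d) ^ 2) /
        (Real.sqrt (1 - 2 * Real.sqrt (η / d)) - c * Real.sqrt (2 / d)) - 1 := by
      rw [delta₁, upperDist_eq hd hη.le, lowerDist_eq hd, two_mul_eq_sqrt hd c, ← mul_sub,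
        mul_div_mul_left _ _ hs]
    have h2 : delta₂ c η d = (Real.sqrt (1 + 2 * Real.sqrt (η / d) + 2 * Real.sqrt (η / d) ^ 2)
        + c * Real.sqrt (2 / d)) /
        (Real.sqrt (1 - 2 * Real.sqrt (η / d)) - c * Real.sqrt (2 / d)) - 1 := by
      rw [delta₂, upperDist_eq hd hη.le, lowerDist_eq hd, two_mul_eq_sqrt hd c, ← mul_sub,
        ← mul_add, mul_div_mul_left _ _ hs]
    have h3 : 10 * (Real.sqrt (η / d) + c * Real.sqrt (2 / d)) ^ 2
        = 10 * (Real.sqrt η + c * Real.sqrt 2) ^ 2 * (1 / d) := by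
      rw [Real.sqrt_div hη.le, Real.sqrt_div (by norm_num), mul_div_assoc', ← add_div, div_pow,
        Real.sq_sqrt hd'.le]
      ring
    rw [h1, h2, ← h3, mul_assoc 2 c]
    exact h
  constructor
  · refine IsBigO.of_bound (10 * (Real.sqrt η + c * Real.sqrt 2) ^ 2) (main.mono fun d hd => ?_)
    rw [Real.norm_eq_abs, Real.norm_of_nonneg (by positivity)]
    exact hd.1
  · refine IsBigO.of_bound (10 * (Real.sqrt η + c * Real.sqrt 2) ^ 2) (main.mono fun d hd => ?_)
    rw [Real.norm_eq_abs, Real.norm_of_nonneg (by positivity)]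
    exact hd.2

lemma isBigO_of_sub_isBigO {g : ℕ → ℝ} {a b η : ℝ} (hη : 0 ≤ η)
    (h : (fun d : ℕ => g d - (a * Real.sqrt (2 / d) + b * Real.sqrt (η / d)))
      =O[atTop] fun d : ℕ => (1 : ℝ) / d) :
    g =O[atTop] fun d : ℕ => (d : ℝ) ^ (-(1 / 2) : ℝ) := by
  have h1 : (fun d : ℕ => (1 : ℝ) / d) =O[atTop] fun d : ℕ => (d : ℝ) ^ (-(1 / 2) : ℝ) := by
    refine IsBigO.of_bound 1 ?_
    filter_upwards [eventually_ge_atTop 1] with d hd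
    have hd' : (1 : ℝ) ≤ d := by exact_mod_cast hd
    rw [Real.norm_of_nonneg (by positivity), Real.norm_of_nonneg (by positivity), one_mul,
      one_div, ← Real.rpow_neg_one]
    exact Real.rpow_le_rpow_of_exponent_le hd' (by norm_num)
  have h2 : (fun d : ℕ => a * Real.sqrt (2 / d) + b * Real.sqrt (η / d))
      =O[atTop] fun d : ℕ => (d : ℝ) ^ (-(1 / 2) : ℝ) := by
    refine ((isBigO_refl _ _).const_mul_left (a * Real.sqrt 2 + b * Real.sqrt η)).congr_left
      fun d => ?_
    rw [sqrt_div_natCast 2 (by norm_num), sqrt_div_natCast η hη]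
    ring
  refine ((h.trans h1).add h2).congr_left fun d => ?_
  ring

end Asymptotics

end HopAndCount

end

open HopAndCount in
theorem mainTheorem5 (c β : ℝ) (hc : 0 < c) (hβ : 0 < β) (hκ : 2 * kappa c < 1) :
    -- asymptotics of the two error terms as the dimension grows
    (∀ η : ℝ, β ≤ η →
      ((fun d : ℕ => delta₁ c η d - (c * Real.sqrt (2 / d) + 2 * Real.sqrt (η / d)))
        =O[atTop] fun d : ℕ => (1 : ℝ) / d) ∧
      ((fun d : ℕ => delta₂ c η d - (2 * c * Real.sqrt (2 / d) + 2 * Real.sqrt (η / d)))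
        =O[atTop] fun d : ℕ => (1 : ℝ) / d) ∧
      ((fun d : ℕ => delta₁ c η d) =O[atTop] fun d : ℕ => (d : ℝ) ^ (-(1 / 2) : ℝ)) ∧
      ((fun d : ℕ => delta₂ c η d) =O[atTop] fun d : ℕ => (d : ℝ) ^ (-(1 / 2) : ℝ))) ∧
    ∀ (d n K : ℕ) (_ : 0 < d) (lab : Fin n → Fin K) (k : Fin K) (f ε δ : ℝ)
      (_ : 0 < f) (_ : f ≤ 1) (_ : 0 < ε) (_ : ε < 1) (_ : 0 < δ) (_ : δ < 1),
      -- dense points are covered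
      (∀ η : ℝ, β ≤ η → 2 * ell c η * freq lab k ≤ f → 2 * c < lowerDist η d →
        1 - kappa c - δ * f
            - Real.exp (-(f * n) / 3) * (Real.exp (kappa c) + Real.exp (ell c β))
          ≤ (law d n (memorySize f ε δ)).real
              ((denseEvent c β f ε δ lab k)ᶜ ∪
                coveredEvent c β f ε δ lab k (delta₁ c η d) (delta₂ c η d)) ∧
        (fHat c f ≤ (1 - 2 * ell c β) * freq lab k →
          1 - kappa c - δ * f
              - Real.exp (-(f * n) / 3) * (Real.exp (kappa c) + Real.exp (ell c β))
            ≤ ((law d n (memorySize f ε δ))[|denseEvent c β f ε δ lab k]).real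
                (coveredEvent c β f ε δ lab k (delta₁ c η d) (delta₂ c η d)))) ∧
      -- sparse points have no output nearby
      (law d n (memorySize f ε δ)).real (falsePositiveEvent c β f ε δ lab k)
        ≤ kappa c + Real.exp (-(f * n) / 3) := by
  refine ⟨fun η hη => ?_, fun d n K hd lab k f ε δ hf _ hε hε1 hδ _ => ⟨fun η hη hell hL => ?_, ?_⟩⟩
  · have hη0 : 0 < η := hβ.trans_le hη
    obtain ⟨h1, h2⟩ := delta_expansions hc hη0
    exact ⟨h1, h2, isBigO_of_sub_isBigO hη0.le h1, isBigO_of_sub_isBigO hη0.le h2⟩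
  · exact law_real_covered_bounds lab k hc hβ hκ hd hf hε hε1 hδ hη hell hL
  · exact law_real_falsePositiveEvent_le lab k hc hβ hκ hd hf hε1
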